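/- All graphs are finite; $H$ and the input graphs $G$ are simple, and an $n$-vertex input graph has $n\ge 1$ and vertex set $\{0,\dots,n-1\}$. A graph $G$ is $\kappa$-degenerate if its vertices can be ordered $v_1,\dots,v_n$ so that each $v_i$ has at most $\kappa$ neighbours in $\{v_{i+1},\dots,v_n\}$. For a partition $P$ of $V(H)$, the quotient graph $H/P$ is the graph (possibly with loops) on the set of parts of $P$ in which parts $U,W$ (possibly equal) are adjacent if and only if $\{u,w\}\in E(H)$ for some $u\in U$, $w\in W$. A homomorphism from a graph $F$ (possibly with loops) to $G$ is a map $V(F)\to V(G)$ sending adjacent pairs to adjacent pairs (so there is none if $F$ has a loop). Let $\hom(F,G)$ be the number of homomorphisms from $F$ to $G$, and $\mathrm{inj}(H,G)$ the number of injective homomorphisms from $H$ to $G$. The problem $\textsc{hom-cnt}_F$ (respectively $\textsc{inj-cnt}_H$) is to compute $\hom(F,G)$ (respectively $\mathrm{inj}(H,G)$) for an input graph $G$, given by its number of vertices and a list of its edges in arbitrary order. Such a problem is called *easy* if there are a randomized algorithm that never outputs a wrong answer (Las Vegas), on a unit-cost word RAM with words of $O(\log n)$ bits, and a function $f:\mathbb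 N\to\mathbb N$ such that for all $\kappa$ and $n\ge 1$ the algorithm solves the problem on every $\kappa$-degenerate $n$-vertex graph $G$ in expected time at most $f(\kappa)\cdot n$. (The algorithm and $f$ may depend on $F$, respectively $H$.) **Lemma 1.10.** Let $H$ be a graph. Then $\textsc{inj-cnt}_H$ is easy if and only if $\textsc{hom-cnt}_{H/P}$ is easy for every partition $P$ of $V(H)$. -/

import Mathlib

/-! ## A randomized word RAM

Words are natural numbers smaller than `2 ^ w`. The machine has registers and random-access arrays
of words (a program mentions only finitely many of each). Every elementary instruction, and every
evaluation of the condition of a branch or of a loop, takes one unit of time. -/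

namespace WordRAM

/-- The arithmetic and bitwise operations on words (`sub` is truncated subtraction, `div` and `mod`
are quotient and remainder). -/
inductive BinOp
  | add | sub | mul | div | mod | and | or | xor | shl | shr

/-- The value of an operation, before it is checked to fit into a word. -/
def BinOp.eval : BinOp → ℕ → ℕ → ℕ
  | .add, a, b => a + b
  | .sub, a, b => a - b
  | .mul, a, b => a * b
  | .div, a, b => a / b
  | .mod, a, b => a % b
  | .and, a, b => a &&& b
  | .or, a, b => a ||| b
  | .xor, a, b => a ^^^ b
  | .shl, a, b => a <<< b
  | .shr, a, b => a >>> b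

/-- Elementary instructions. The arguments `d x y i` are names of registers. -/
inductive Instr
  /-- Put the constant `k` into register `d`. -/
  | const (d k : ℕ)
  /-- Put the result of `o`, applied to registers `x` and `y`, into register `d`. -/
  | bin (o : BinOp) (d x y : ℕ)
  /-- Put the entry of array `a` at the address held in register `i` into register `d`. -/
  | load (d a i : ℕ)
  /-- Write register `x` into array `a` at the address held in register `i`. -/
  | store (a i x : ℕ)
  /-- Put a uniformly random element of `{0, …, r}` into register `d`, where `r` is the content of
  register `x`; all random choices are independent. -/
  | rand (d x : ℕ)

/-- Programs: finite pieces of code built from instructions, branches and loops. -/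
inductive Code
  /-- Stop. -/
  | halt
  /-- Execute an instruction and continue with `next`. -/
  | instr (o : Instr) (next : Code)
  /-- If register `x` is smaller than register `y` execute `a`, otherwise `b`; then `next`. -/
  | ifLt (x y : ℕ) (a b next : Code)
  /-- As long as register `x` is smaller than register `y`, execute `body`; then `next`. -/
  | whileLt (x y : ℕ) (body next : Code)

/-- `a.append b` executes `a` and then `b`. -/
def Code.append : Code → Code → Code
  | .halt, c => c
  | .instr o next, c => .instr o (next.append c)
  | .ifLt x y a b next, c => .ifLt x y a b (next.append c)
  | .whileLt x y body next, c => .whileLt x y body (next.append c)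

/-- The contents of the registers and of the arrays. -/
@[ext]
structure Store where
  reg : ℕ → ℕ
  arr : ℕ → ℕ → ℕ

/-- Overwrite register `d` by `v`. -/
def Store.setReg (s : Store) (d v : ℕ) : Store :=
  { s with reg := Function.update s.reg d v }

/-- Overwrite the entry of array `a` at address `i` by `v`. -/
def Store.setArr (s : Store) (a i v : ℕ) : Store :=
  { s with arr := Function.update s.arr a (Function.update (s.arr a) i v) }

/-- A configuration: the code that remains to be executed, and the current store. -/
@[ext]
structure Config where
  code : Code
  store : Store

/-- The machine has stopped. -/
def Config.Halted (c : Config) : Prop := c.code = Code.halt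

open Classical in
/-- One step of the machine with words of `w` bits. An instruction whose result does not fit into a
word cannot be executed: the machine then hangs forever in its current configuration. A halted
machine stays as it is. -/
noncomputable def step (w : ℕ) : Config → PMF Config
  | ⟨.halt, s⟩ => PMF.pure ⟨.halt, s⟩
  | ⟨.instr (.const d k) next, s⟩ =>
      if k < 2 ^ w then PMF.pure ⟨next, s.setReg d k⟩
      else PMF.pure ⟨.instr (.const d k) next, s⟩
  | ⟨.instr (.bin o d x y) next, s⟩ =>
      if o.eval (s.reg x) (s.reg y) < 2 ^ w then
        PMF.pure ⟨next, s.setReg d (o.eval (s.reg x) (s.reg y))⟩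
      else PMF.pure ⟨.instr (.bin o d x y) next, s⟩
  | ⟨.instr (.load d a i) next, s⟩ => PMF.pure ⟨next, s.setReg d (s.arr a (s.reg i))⟩
  | ⟨.instr (.store a i x) next, s⟩ => PMF.pure ⟨next, s.setArr a (s.reg i) (s.reg x)⟩
  | ⟨.instr (.rand d x) next, s⟩ =>
      (PMF.uniformOfFintype (Fin (s.reg x + 1))).map fun r => ⟨next, s.setReg d r⟩
  | ⟨.ifLt x y a b next, s⟩ =>
      if s.reg x < s.reg y then PMF.pure ⟨a.append next, s⟩ else PMF.pure ⟨b.append next, s⟩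
  | ⟨.whileLt x y body next, s⟩ =>
      if s.reg x < s.reg y then PMF.pure ⟨body.append (.whileLt x y body next), s⟩
      else PMF.pure ⟨next, s⟩

/-- The distribution of the configuration after `t` steps, starting from `c`. -/
noncomputable def runDist (w : ℕ) : ℕ → Config → PMF Config
  | 0, c => PMF.pure c
  | t + 1, c => (step w c).bind (runDist w t)

/-- The expectation of the number `T` of steps until the machine halts, as the sum over `t` of the
probabilities of `T > t`; it is `∞` if the machine fails to halt with positive probability. -/
noncomputable def expectedTime (w : ℕ) (c : Config) : ENNReal :=
  ∑' t : ℕ, (runDist w t c).toOuterMeasure {c' | ¬ c'.Halted}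

/-- Started in `c`, the machine never halts with a wrong answer: in every halted configuration that
is reached with positive probability, register `0` holds `out`. -/
def AlwaysOutputs (w : ℕ) (c : Config) (out : ℕ) : Prop :=
  ∀ t, ∀ c' ∈ (runDist w t c).support, c'.Halted → c'.store.reg 0 = out

end WordRAM

/-! ## Graphs, counts, and easy counting problems -/

namespace SubgraphCounting

/-- `G` is `κ`-degenerate: for some ordering of the vertices, each vertex has at most `κ` neighbours
among the later ones. -/
def IsDegenerate (κ : ℕ) {n : ℕ} (G : SimpleGraph (Fin n)) : Prop :=
  ∃ v : Equiv.Perm (Fin n), ∀ i, {j | i < j ∧ G.Adj (v i) (v j)}.ncard ≤ κ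

/-- The list `E` contains every edge of `G` exactly once, in one of its two orientations, and
nothing else. -/
def IsEdgeList {n : ℕ} (G : SimpleGraph (Fin n)) (E : List (Fin n × Fin n)) : Prop :=
  (E.map fun e => s(e.1, e.2)).Nodup ∧ ∀ u v, s(u, v) ∈ E.map (fun e => s(e.1, e.2)) ↔ G.Adj u v

/-- The input of the machine for a graph on `{0, …, n - 1}` with edge list `E`: the number of
vertices and the number of edges are in registers `0` and `1`, the two endpoints of the `i`-th edge
are at address `i` in arrays `0` and `1`; everything else is `0`. -/
def input (n : ℕ) (E : List (Fin n × Fin n)) : WordRAM.Store where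
  reg r := if r = 0 then n else if r = 1 then E.length else 0
  arr a i := if a = 0 then (E.map fun e => (e.1 : ℕ)).getD i 0
    else if a = 1 then (E.map fun e => (e.2 : ℕ)).getD i 0 else 0

/-- The problem of computing the graph parameter `cnt` is easy: there are a randomized (Las Vegas)
algorithm on a word RAM with words of `O(log n)` bits and a function `f` such that, for all `κ`, the
algorithm computes `cnt G` in expected time at most `f κ * n` for every `κ`-degenerate graph `G`
with `n ≥ 1` vertices, in whatever order its edges are listed. -/
def IsEasy (cnt : ∀ n : ℕ, SimpleGraph (Fin n) → ℕ) : Prop :=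
  ∃ (A : WordRAM.Code) (b : ℕ) (f : ℕ → ℕ),
    ∀ (κ n : ℕ), 1 ≤ n → ∀ G : SimpleGraph (Fin n), IsDegenerate κ G →
      ∀ E : List (Fin n × Fin n), IsEdgeList G E →
        WordRAM.AlwaysOutputs (b * (Nat.log 2 n + 1)) ⟨A, input n E⟩ (cnt n G) ∧
        WordRAM.expectedTime (b * (Nat.log 2 n + 1)) ⟨A, input n E⟩ ≤ ((f κ * n : ℕ) : ENNReal)

/-- Graphs that may have loops (but no multiple edges). -/
@[ext]
structure LoopGraph (V : Type*) where
  Adj : V → V → Prop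
  symm : ∀ ⦃u v⦄, Adj u v → Adj v u

/-- The quotient graph `H / P`: its vertices are the parts of `P`, and two (possibly equal) parts
are adjacent if some edge of `H` joins them. -/
def quotientGraph {V : Type*} [Fintype V] [DecidableEq V] (H : SimpleGraph V)
    (P : Finpartition (Finset.univ : Finset V)) : LoopGraph {U : Finset V // U ∈ P.parts} where
  Adj U W := ∃ u ∈ U.1, ∃ w ∈ W.1, H.Adj u w
  symm := fun _ _ ⟨u, hu, w, hw, h⟩ => ⟨w, hw, u, hu, h.symm⟩

/-- The number of homomorphisms from `F` to `G`. -/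
noncomputable def homCount {V W : Type*} (F : LoopGraph V) (G : SimpleGraph W) : ℕ :=
  Nat.card (F.Adj →r G.Adj)

/-- The number of injective homomorphisms from `H` to `G`. -/
noncomputable def injCount {V W : Type*} (H : SimpleGraph V) (G : SimpleGraph W) : ℕ :=
  Nat.card {φ : H →g G // Function.Injective φ}

/-- The problem of computing the number of homomorphisms from `F` to the input graph is easy. -/
def HomCntEasy {V : Type*} (F : LoopGraph V) : Prop := IsEasy fun _ G => homCount F G

/-- The problem of computing the number of injective homomorphisms from `H` to the input graph is
easy. -/
def InjCntEasy {V : Type*} (H : SimpleGraph V) : Prop := IsEasy fun _ G => injCount H G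

end SubgraphCounting

/-! Write `fixCount H σ R` for the number of homomorphisms from `H` to `R` that are constant on the
orbits of a permutation `σ` of `V(H)`. For `R = G` this is the homomorphism count of `H/P`, where
`P` is the orbit partition of `σ`, and every partition arises in this way. If a map `φ` identifies
two vertices, multiplication by their transposition pairs off the permutations with `φ ∘ σ = φ` with
opposite signs. Hence inj(H, G) is the sum of `sign σ * fixCount H σ G` over all `σ`, so a linear
combination of easy problems. This is one direction.

For the converse, replace `G` by its tensor product with a fixed graph `F`, possibly with loops.
Homomorphism counts are multiplicative in the target, so the `σ`-term acquires the factor `fixCount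
H σ F`. Let `F` run through the induced subgraphs of the quotient of `H` by `τ`. Inclusion-exclusion
turns this factor into the number of homomorphisms from the quotient by `σ` to the quotient by `τ`
that are surjective on vertices. Only the `σ` that dominate `τ` survive. Those that dominate it
strictly are known by well-founded induction and can be subtracted. If `σ` and `τ` dominate each
other, their homomorphism counts into `G` agree, and so do their numbers of orbits and hence their
signs. The remaining terms therefore cannot cancel, and what is left is a fixed nonzero multiple of
the wanted count.

On the machine side one needs that easy problems stay easy under tensoring with a fixed graph and
under integer linear combinations. The tensor product has `k * n` vertices and degeneracy at most `k
* κ`, and its edge list is written in time linear in the number of edges, which is at most `κ * n`.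
A given algorithm is then run on it with renamed registers and arrays and possibly longer words. A
small program logic, `Ensures`, closed under sequencing, renaming and longer words, justifies this.
-/

namespace WordRAM

/-! ### A program logic for the randomized word RAM -/

open scoped ENNReal

/-! ### Reachability and expected running time -/

/-- `d` is reached from `c` with positive probability. -/
inductive Reach (w : ℕ) : Config → Config → Prop
  | refl (c : Config) : Reach w c c
  | head {c c' d : Config} : c' ∈ (step w c).support → Reach w c' d → Reach w c d

theorem exists_mem_support_runDist_iff {w : ℕ} {c d : Config} :
    (∃ t, d ∈ (runDist w t c).support) ↔ Reach w c d := by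
  constructor
  · rintro ⟨t, ht⟩
    induction t generalizing c with
    | zero =>
      rw [runDist, PMF.support_pure, Set.mem_singleton_iff] at ht
      exact ht ▸ Reach.refl _
    | succ t ih =>
      rw [runDist, PMF.mem_support_bind_iff] at ht
      obtain ⟨c', hc', hd⟩ := ht
      exact .head hc' (ih hd)
  · intro h
    induction h with
    | refl c => exact ⟨0, by simp [runDist]⟩
    | head hc _ ih =>
      obtain ⟨t, ht⟩ := ih
      exact ⟨t + 1, by rw [runDist, PMF.mem_support_bind_iff]; exact ⟨_, hc, ht⟩⟩

/-- The expected number of steps among the first `N` ones at whose beginning the machine has not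
halted. -/
noncomputable def truncTime (w N : ℕ) (c : Config) : ℝ≥0∞ :=
  ∑ t ∈ Finset.range N, (runDist w t c).toOuterMeasure {c' | ¬ c'.Halted}

theorem truncTime_zero (w : ℕ) (c : Config) : truncTime w 0 c = 0 := by simp [truncTime]

-- First-step analysis. Truncating the time permits induction on the number of steps even where the
-- expected time may be infinite.
open Classical in
theorem truncTime_succ (w N : ℕ) (c : Config) :
    truncTime w (N + 1) c =
      (if c.Halted then 0 else 1) + ∑' c', step w c c' * truncTime w N c' := by
  rw [truncTime, Finset.sum_range_succ', add_comm]
  congr 1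
  · simp only [runDist, PMF.toOuterMeasure_pure_apply, Set.mem_ofPred_eq]
    by_cases h : c.Halted <;> simp [h]
  · simp only [runDist, PMF.toOuterMeasure_bind_apply, truncTime, Finset.mul_sum]
    exact (Summable.tsum_finsetSum fun _ _ => ENNReal.summable).symm

theorem expectedTime_eq_iSup (w : ℕ) (c : Config) : expectedTime w c = ⨆ N, truncTime w N c :=
  ENNReal.tsum_eq_iSup_nat

theorem truncTime_le_expectedTime (w N : ℕ) (c : Config) : truncTime w N c ≤ expectedTime w c := by
  rw [expectedTime_eq_iSup]
  exact le_iSup (fun N => truncTime w N c) N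

open Classical in
theorem expectedTime_eq_add (w : ℕ) (c : Config) :
    expectedTime w c =
      (if c.Halted then 0 else 1) + ∑' c', step w c c' * expectedTime w c' := by
  rw [expectedTime, tsum_eq_zero_add' ENNReal.summable]
  congr 1
  · simp only [runDist, PMF.toOuterMeasure_pure_apply, Set.mem_ofPred_eq]
    by_cases h : c.Halted <;> simp [h]
  · simp only [runDist, PMF.toOuterMeasure_bind_apply, expectedTime, ← ENNReal.tsum_mul_left]
    exact ENNReal.tsum_comm

theorem tsum_pure_mul {α : Type*} (a : α) (g : α → ℝ≥0∞) :
    ∑' x, (PMF.pure a : PMF α) x * g x = g a := by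
  rw [tsum_eq_single a]
  · simp
  · intro b hb
    simp [PMF.pure_apply, hb]

theorem tsum_map_mul {α β : Type*} (p : PMF α) (g : α → β) (h : β → ℝ≥0∞) :
    ∑' y, p.map g y * h y = ∑' x, p x * h (g x) := by
  classical
  simp only [PMF.map_apply, ← ENNReal.tsum_mul_right]
  rw [ENNReal.tsum_comm]
  refine tsum_congr fun x => ?_
  rw [tsum_eq_single (g x)]
  · simp
  · intro b hb
    simp [hb]

theorem expectedTime_halt (w : ℕ) (s : Store) : expectedTime w ⟨.halt, s⟩ = 0 := by
  rw [expectedTime, ENNReal.tsum_eq_zero]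
  intro t
  induction t with
  | zero => simp [runDist, Config.Halted]
  | succ t ih => rw [runDist, step, PMF.pure_bind, ih]

theorem expectedTime_of_step_eq_pure {w : ℕ} {c d : Config} (hc : ¬ c.Halted)
    (h : step w c = PMF.pure d) : expectedTime w c = expectedTime w d + 1 := by
  rw [expectedTime_eq_add, h, tsum_pure_mul, if_neg hc, add_comm]

theorem Reach.eq_of_halted {w : ℕ} {c d : Config} (h : Reach w c d) (hc : c.Halted) : d = c := by
  induction h with
  | refl => rfl
  | @head c c' d hc' _ ih =>
    obtain ⟨code, s⟩ := c
    cases hc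
    rw [step, PMF.support_pure, Set.mem_singleton_iff] at hc'
    subst hc'
    exact ih rfl

/-! ### Total correctness with a time bound -/

/-- Started in store `s`, the code `A` takes expected time at most `K`, and whenever it halts, the
final store satisfies `Q`. -/
structure Ensures (w : ℕ) (A : Code) (s : Store) (K : ℕ) (Q : Store → Prop) : Prop where
  post : ∀ t, Reach w ⟨A, s⟩ ⟨.halt, t⟩ → Q t
  time : expectedTime w ⟨A, s⟩ ≤ K

theorem ensures_iff {w : ℕ} {A : Code} {s : Store} {K out : ℕ} :
    AlwaysOutputs w ⟨A, s⟩ out ∧ expectedTime w ⟨A, s⟩ ≤ K ↔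
      Ensures w A s K (fun t => t.reg 0 = out) := by
  constructor
  · rintro ⟨h, hK⟩
    refine ⟨fun t ht => ?_, hK⟩
    obtain ⟨i, hi⟩ := exists_mem_support_runDist_iff.2 ht
    exact h i _ hi rfl
  · rintro ⟨h, hK⟩
    refine ⟨fun i ⟨code, t⟩ hc hh => ?_, hK⟩
    cases hh
    exact h t (exists_mem_support_runDist_iff.1 ⟨i, hc⟩)

theorem Ensures.mono {w : ℕ} {A : Code} {s : Store} {K K' : ℕ} {Q Q' : Store → Prop}
    (h : Ensures w A s K Q) (hK : K ≤ K') (hQ : ∀ t, Q t → Q' t) : Ensures w A s K' Q' :=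
  ⟨fun t ht => hQ t (h.post t ht), h.time.trans (by exact_mod_cast hK)⟩

theorem ensures_halt {w : ℕ} {s : Store} {Q : Store → Prop} (h : Q s) :
    Ensures w .halt s 0 Q := by
  refine ⟨fun t ht => ?_, by simp [expectedTime_halt]⟩
  have := ht.eq_of_halted rfl
  cases this
  exact h

theorem Ensures.of_step {w : ℕ} {A B : Code} {s s' : Store} {K : ℕ} {Q : Store → Prop}
    (hA : A ≠ .halt) (hstep : step w ⟨A, s⟩ = PMF.pure ⟨B, s'⟩) (h : Ensures w B s' K Q) :
    Ensures w A s (K + 1) Q := by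
  refine ⟨fun t ht => ?_, ?_⟩
  · cases ht with
    | refl => exact absurd rfl hA
    | head hc hr =>
      rw [hstep, PMF.support_pure, Set.mem_singleton_iff] at hc
      subst hc
      exact h.post t hr
  · rw [expectedTime_of_step_eq_pure (c := ⟨A, s⟩) hA hstep]
    push_cast
    gcongr
    exact h.time

section Rules

variable {w K : ℕ} {next : Code} {s : Store} {Q : Store → Prop}

theorem ensures_const {d k : ℕ} (hk : k < 2 ^ w) (h : Ensures w next (s.setReg d k) K Q) :
    Ensures w (.instr (.const d k) next) s (K + 1) Q :=
  .of_step (by simp) (by rw [step, if_pos hk]) h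

theorem ensures_bin {o : BinOp} {d x y : ℕ} (hk : o.eval (s.reg x) (s.reg y) < 2 ^ w)
    (h : Ensures w next (s.setReg d (o.eval (s.reg x) (s.reg y))) K Q) :
    Ensures w (.instr (.bin o d x y) next) s (K + 1) Q :=
  .of_step (by simp) (by rw [step, if_pos hk]) h

theorem ensures_load {d a i : ℕ} (h : Ensures w next (s.setReg d (s.arr a (s.reg i))) K Q) :
    Ensures w (.instr (.load d a i) next) s (K + 1) Q :=
  .of_step (by simp) (by rw [step]) h

theorem ensures_store {a i x : ℕ}
    (h : Ensures w next (s.setArr a (s.reg i) (s.reg x)) K Q) :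
    Ensures w (.instr (.store a i x) next) s (K + 1) Q :=
  .of_step (by simp) (by rw [step]) h

end Rules

/-! ### Sequential composition -/

theorem Code.append_assoc (A B C : Code) : (A.append B).append C = A.append (B.append C) := by
  induction A <;> simp_all [Code.append]

/-- The halted case is excluded because there `B` already runs while `A` stays put. -/
theorem step_append (w : ℕ) {A : Code} (hA : A ≠ .halt) (B : Code) (s : Store) :
    step w ⟨A.append B, s⟩ = (step w ⟨A, s⟩).map fun c => ⟨c.code.append B, c.store⟩ := by
  cases A with
  | halt => exact absurd rfl hA
  | instr o next =>
    cases o <;> simp only [Code.append, step, PMF.pure_map, PMF.map_comp]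
    · split_ifs <;> simp [PMF.pure_map, Code.append]
    · split_ifs <;> simp [PMF.pure_map, Code.append]
    · rfl
  | ifLt x y a b next =>
    simp only [Code.append, step]
    split_ifs <;> simp [PMF.pure_map, Code.append_assoc]
  | whileLt x y body next =>
    simp only [Code.append, step]
    split_ifs <;> simp [PMF.pure_map, Code.append_assoc, Code.append]

theorem Reach.of_append {w : ℕ} {A B : Code} {s t : Store}
    (h : Reach w ⟨A.append B, s⟩ ⟨.halt, t⟩) :
    ∃ s', Reach w ⟨A, s⟩ ⟨.halt, s'⟩ ∧ Reach w ⟨B, s'⟩ ⟨.halt, t⟩ := by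
  generalize hc : (⟨A.append B, s⟩ : Config) = c at h
  generalize hd : (⟨.halt, t⟩ : Config) = d at h
  induction h generalizing A s with
  | refl c =>
    by_cases hA : A = .halt
    · subst hA
      exact ⟨s, .refl _, by
        rw [show (⟨B, s⟩ : Config) = c from hc]; exact .refl _⟩
    · subst hc
      exfalso
      cases A <;> simp_all [Code.append]
  | @head c c' d hc' hr ih =>
    subst hc hd
    by_cases hA : A = .halt
    · subst hA
      exact ⟨s, .refl _, .head hc' hr⟩
    · rw [step_append w hA, PMF.mem_support_map_iff] at hc'
      obtain ⟨⟨A', s₁⟩, h₁, h₂⟩ := hc'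
      obtain ⟨s', hs', ht⟩ := ih h₂ rfl
      exact ⟨s', .head h₁ hs', ht⟩

/-- Induction on `N` by first-step analysis: the step probabilities sum to one, so averaging over
the first step adds `K` only once. -/
theorem truncTime_append_le {w : ℕ} {B : Code} {K : ℝ≥0∞} (N : ℕ) {A : Code} {s : Store}
    (hB : ∀ t, Reach w ⟨A, s⟩ ⟨.halt, t⟩ → expectedTime w ⟨B, t⟩ ≤ K) :
    truncTime w N ⟨A.append B, s⟩ ≤ truncTime w N ⟨A, s⟩ + K := by
  classical
  induction N generalizing A s with
  | zero => simp [truncTime_zero]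
  | succ N ih =>
    by_cases hA : A = .halt
    · subst hA
      exact (truncTime_le_expectedTime _ _ _).trans ((hB s (.refl _)).trans le_add_self)
    · have h₁ : ¬ Config.Halted ⟨A, s⟩ := hA
      have h₂ : ¬ Config.Halted ⟨A.append B, s⟩ := by
        cases A <;> simp_all [Code.append, Config.Halted]
      rw [truncTime_succ, truncTime_succ, if_neg h₁, if_neg h₂, step_append w hA, tsum_map_mul,
        add_assoc]
      gcongr
      calc ∑' x, step w ⟨A, s⟩ x * truncTime w N ⟨x.code.append B, x.store⟩
          ≤ ∑' x, (step w ⟨A, s⟩ x * truncTime w N x + step w ⟨A, s⟩ x * K) := by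
            refine ENNReal.tsum_le_tsum fun x => ?_
            rw [← mul_add]
            by_cases hx : x ∈ (step w ⟨A, s⟩).support
            · gcongr
              exact ih fun t ht => hB t (.head hx ht)
            · rw [PMF.mem_support_iff, not_not] at hx
              simp [hx]
        _ = _ := by
            rw [ENNReal.tsum_add, ENNReal.tsum_mul_right, PMF.tsum_coe, one_mul]

theorem Ensures.append {w : ℕ} {A B : Code} {s : Store} {K K' : ℕ} {Q R : Store → Prop}
    (hA : Ensures w A s K Q) (hB : ∀ t, Q t → Ensures w B t K' R) :
    Ensures w (A.append B) s (K + K') R := by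
  refine ⟨fun t ht => ?_, ?_⟩
  · obtain ⟨s', h₁, h₂⟩ := ht.of_append
    exact (hB s' (hA.post s' h₁)).post t h₂
  · rw [expectedTime_eq_iSup]
    refine iSup_le fun N => ?_
    refine (truncTime_append_le N fun t ht => (hB t (hA.post t ht)).time).trans ?_
    push_cast
    gcongr
    exact (truncTime_le_expectedTime _ _ _).trans hA.time

/-- The invariant is indexed by the number of completed rounds, which is exactly `N` in the end.
Each round pays one unit for its test, and the failing test accounts for the last unit. -/
theorem ensures_whileLt {w : ℕ} {x y : ℕ} {body next : Code} {K K' N : ℕ} {Q : Store → Prop}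
    (I : ℕ → Store → Prop)
    (hbody : ∀ j < N, ∀ s, I j s → s.reg x < s.reg y ∧ Ensures w body s K (I (j + 1)))
    (hnext : ∀ s, I N s → ¬ s.reg x < s.reg y ∧ Ensures w next s K' Q) {s : Store} (h₀ : I 0 s) :
    Ensures w (.whileLt x y body next) s (N * (K + 1) + K' + 1) Q := by
  suffices ∀ i j s, j + i = N → I j s →
      Ensures w (.whileLt x y body next) s (i * (K + 1) + K' + 1) Q from
    this N 0 s (zero_add _) h₀
  intro i
  induction i with
  | zero =>
    rintro j s rfl hs
    obtain ⟨h₁, h₂⟩ := hnext s hs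
    exact (Ensures.of_step (by simp) (by rw [step, if_neg h₁]) h₂).mono (by simp) fun _ h => h
  | succ i ih =>
    intro j s hj hs
    obtain ⟨h₁, h₂⟩ := hbody j (by omega) s hs
    have h₃ := h₂.append fun t ht => ih (j + 1) t (by omega) ht
    exact (Ensures.of_step (by simp) (by rw [step, if_pos h₁]) h₃).mono
      (by rw [add_one_mul]; omega) fun _ h => h

/-! ### Larger words -/

theorem step_eq_or_stuck {w w' : ℕ} (hw : w ≤ w') (c : Config) :
    step w' c = step w c ∨ ¬ c.Halted ∧ step w c = PMF.pure c := by
  have hpow : 2 ^ w ≤ 2 ^ w' := Nat.pow_le_pow_right (by norm_num) hw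
  obtain ⟨A, s⟩ := c
  rcases A with _ | ⟨o, next⟩ | ⟨x, y, a, b, next⟩ | ⟨x, y, body, next⟩
  · exact .inl rfl
  · cases o with
    | const d k =>
      by_cases h : k < 2 ^ w
      · exact .inl (by rw [step, step, if_pos h, if_pos (h.trans_le hpow)])
      · exact .inr ⟨by simp [Config.Halted], by rw [step, if_neg h]⟩
    | bin o d x y =>
      by_cases h : o.eval (s.reg x) (s.reg y) < 2 ^ w
      · exact .inl (by rw [step, step, if_pos h, if_pos (h.trans_le hpow)])
      · exact .inr ⟨by simp [Config.Halted], by rw [step, if_neg h]⟩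
    | load => exact .inl rfl
    | store => exact .inl rfl
    | rand => exact .inl rfl
  · exact .inl rfl
  · exact .inl rfl

theorem step_eq_of_expectedTime_ne_top {w w' : ℕ} (hw : w ≤ w') {c : Config}
    (h : expectedTime w c ≠ ∞) : step w' c = step w c := by
  rcases step_eq_or_stuck hw c with h' | ⟨h₁, h₂⟩
  · exact h'
  · have h₃ := expectedTime_of_step_eq_pure h₁ h₂
    exact absurd h₃ (ENNReal.lt_add_right h one_ne_zero).ne

theorem expectedTime_ne_top_of_mem_support {w : ℕ} {c d : Config} (h : expectedTime w c ≠ ∞)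
    (hd : d ∈ (step w c).support) : expectedTime w d ≠ ∞ := by
  intro htop
  refine h (top_unique ?_)
  rw [expectedTime_eq_add]
  refine le_trans ?_ le_add_self
  refine le_trans ?_ (ENNReal.le_tsum d)
  rw [htop, ENNReal.mul_top ((PMF.mem_support_iff _ _).1 hd)]

theorem truncTime_eq_of_expectedTime_ne_top {w w' : ℕ} (hw : w ≤ w') (N : ℕ) {c : Config}
    (h : expectedTime w c ≠ ∞) : truncTime w' N c = truncTime w N c := by
  classical
  induction N generalizing c with
  | zero => simp [truncTime_zero]
  | succ N ih =>
    rw [truncTime_succ, truncTime_succ, step_eq_of_expectedTime_ne_top hw h]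
    congr 1
    refine tsum_congr fun d => ?_
    by_cases hd : d ∈ (step w c).support
    · rw [ih (expectedTime_ne_top_of_mem_support h hd)]
    · rw [PMF.mem_support_iff, not_not] at hd
      simp [hd]

theorem Reach.of_le {w w' : ℕ} (hw : w ≤ w') {c d : Config} (hr : Reach w' c d)
    (h : expectedTime w c ≠ ∞) : Reach w c d := by
  induction hr with
  | refl => exact .refl _
  | head hc _ ih =>
    rw [step_eq_of_expectedTime_ne_top hw h] at hc
    exact .head hc (ih (expectedTime_ne_top_of_mem_support h hc))

/-- Longer words only alter steps at which the machine would hang, and a run of finite expected time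
never gets there. -/
theorem Ensures.of_le {w w' : ℕ} (hw : w ≤ w') {A : Code} {s : Store} {K : ℕ} {Q : Store → Prop}
    (h : Ensures w A s K Q) : Ensures w' A s K Q := by
  have htop : expectedTime w ⟨A, s⟩ ≠ ∞ := ne_top_of_le_ne_top (ENNReal.natCast_ne_top K) h.time
  refine ⟨fun t ht => h.post t (ht.of_le hw htop), ?_⟩
  rw [expectedTime_eq_iSup]
  simp only [truncTime_eq_of_expectedTime_ne_top hw _ htop, ← expectedTime_eq_iSup]
  exact h.time

/-! ### Renaming registers and arrays -/

/-- Rename registers and arrays. -/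
def Instr.rename (ρ : ℕ → ℕ) : Instr → Instr
  | .const d k => .const (ρ d) k
  | .bin o d x y => .bin o (ρ d) (ρ x) (ρ y)
  | .load d a i => .load (ρ d) (ρ a) (ρ i)
  | .store a i x => .store (ρ a) (ρ i) (ρ x)
  | .rand d x => .rand (ρ d) (ρ x)

/-- Rename registers and arrays. -/
def Code.rename (ρ : ℕ → ℕ) : Code → Code
  | .halt => .halt
  | .instr o next => .instr (o.rename ρ) (next.rename ρ)
  | .ifLt x y a b next => .ifLt (ρ x) (ρ y) (a.rename ρ) (b.rename ρ) (next.rename ρ)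
  | .whileLt x y body next => .whileLt (ρ x) (ρ y) (body.rename ρ) (next.rename ρ)

theorem Code.rename_append (ρ : ℕ → ℕ) (A B : Code) :
    (A.append B).rename ρ = (A.rename ρ).append (B.rename ρ) := by
  induction A <;> simp_all [Code.append, Code.rename]

/-- The store `s`, moved along `ρ`, inside of the store `t`. -/
noncomputable def Store.embed (ρ : ℕ → ℕ) (t s : Store) : Store where
  reg := Function.extend ρ s.reg t.reg
  arr := Function.extend ρ s.arr t.arr

theorem extend_update {α β γ : Type*} [DecidableEq α] [DecidableEq β] {f : α → β}
    (hf : Function.Injective f) (g : α → γ) (e : β → γ) (a : α) (v : γ) :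
    Function.extend f (Function.update g a v) e =
      Function.update (Function.extend f g e) (f a) v := by
  ext b
  by_cases hb : ∃ a', f a' = b
  · obtain ⟨a', rfl⟩ := hb
    rw [hf.extend_apply]
    by_cases h : a' = a
    · subst h; simp
    · rw [Function.update_of_ne h, Function.update_of_ne (hf.ne h), hf.extend_apply]
  · rw [Function.extend_apply' _ _ _ hb, Function.update_of_ne, Function.extend_apply' _ _ _ hb]
    rintro rfl
    exact hb ⟨a, rfl⟩

section Rename

variable {ρ : ℕ → ℕ}

theorem Store.embed_reg (hρ : Function.Injective ρ) (t s : Store) (r : ℕ) : (Store.embed ρ t s).reg (ρ r) = s.reg r :=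
  hρ.extend_apply _ _ _

theorem Store.embed_arr (hρ : Function.Injective ρ) (t s : Store) (a : ℕ) : (Store.embed ρ t s).arr (ρ a) = s.arr a :=
  hρ.extend_apply _ _ _

theorem Store.embed_setReg (hρ : Function.Injective ρ) (t s : Store) (d v : ℕ) :
    Store.embed ρ t (s.setReg d v) = (Store.embed ρ t s).setReg (ρ d) v := by
  simp [Store.embed, Store.setReg, extend_update hρ]

theorem Store.embed_setArr (hρ : Function.Injective ρ) (t s : Store) (a i v : ℕ) :
    Store.embed ρ t (s.setArr a i v) = (Store.embed ρ t s).setArr (ρ a) i v := by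
  simp [Store.embed, Store.setArr, extend_update hρ, hρ.extend_apply]

theorem step_rename (hρ : Function.Injective ρ) (t : Store)
    (w : ℕ) (A : Code) (s : Store) :
    step w ⟨A.rename ρ, Store.embed ρ t s⟩ =
      (step w ⟨A, s⟩).map fun c => ⟨c.code.rename ρ, Store.embed ρ t c.store⟩ := by
  rcases A with _ | ⟨o, next⟩ | ⟨x, y, a, b, next⟩ | ⟨x, y, body, next⟩
  · simp [step, Code.rename, PMF.pure_map]
  · rcases o with _ | _ | _ | _ | ⟨d, x⟩
    case rand =>
      simp only [Code.rename, Instr.rename, step, PMF.map_comp, Function.comp_def,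
        Store.embed_setReg hρ]
      -- The range of the random draw depends on a register, so the proof attached to that type has
      -- to be abstracted before the register content can be rewritten.
      generalize_proofs h
      revert h
      rw [Store.embed_reg hρ]
      exact fun _ => rfl
    all_goals simp only [Code.rename, Instr.rename, step, PMF.pure_map, Store.embed_reg hρ,
      Store.embed_arr hρ, Store.embed_setReg hρ, Store.embed_setArr hρ]
    all_goals split_ifs <;>
      simp [PMF.pure_map, Store.embed_setReg hρ, Code.rename, Instr.rename]
  · simp only [Code.rename, step, Store.embed_reg hρ]
    split_ifs <;> simp [PMF.pure_map, Code.rename_append]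
  · simp only [Code.rename, step, Store.embed_reg hρ]
    split_ifs <;> simp [PMF.pure_map, Code.rename_append, Code.rename]

theorem truncTime_rename (hρ : Function.Injective ρ) (t : Store)
    (w N : ℕ) (A : Code) (s : Store) :
    truncTime w N ⟨A.rename ρ, Store.embed ρ t s⟩ = truncTime w N ⟨A, s⟩ := by
  classical
  induction N generalizing A s with
  | zero => simp [truncTime_zero]
  | succ N ih =>
    rw [truncTime_succ, truncTime_succ, step_rename hρ, tsum_map_mul]
    congr 1
    · cases A <;> simp [Config.Halted, Code.rename]
    · simp only [ih]

theorem Reach.of_rename (hρ : Function.Injective ρ) {t : Store} {w : ℕ} {A : Code} {s t' : Store}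
    (h : Reach w ⟨A.rename ρ, Store.embed ρ t s⟩ ⟨.halt, t'⟩) :
    ∃ s', Reach w ⟨A, s⟩ ⟨.halt, s'⟩ ∧ t' = Store.embed ρ t s' := by
  generalize hc : (⟨A.rename ρ, Store.embed ρ t s⟩ : Config) = c at h
  generalize hd : (⟨.halt, t'⟩ : Config) = d at h
  induction h generalizing A s with
  | refl c =>
    subst hc
    cases A <;> simp_all [Code.rename]
    exact ⟨s, .refl _, rfl⟩
  | head hc' _ ih =>
    subst hc
    rw [step_rename hρ, PMF.mem_support_map_iff] at hc'
    obtain ⟨⟨A', s₁⟩, h₁, h₂⟩ := hc'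
    obtain ⟨s', hs', ht⟩ := ih h₂ hd
    exact ⟨s', .head h₁ hs', ht⟩

theorem Ensures.rename (hρ : Function.Injective ρ) (t : Store) {w : ℕ} {A : Code} {s : Store} {K : ℕ} {Q : Store → Prop}
    (h : Ensures w A s K Q) :
    Ensures w (A.rename ρ) (Store.embed ρ t s) K
      fun t' => ∃ s', Q s' ∧ t' = Store.embed ρ t s' := by
  refine ⟨fun t' ht => ?_, ?_⟩
  · obtain ⟨s', h₁, h₂⟩ := ht.of_rename hρ
    exact ⟨s', h.post s' h₁, h₂⟩
  · rw [expectedTime_eq_iSup]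
    simp only [truncTime_rename hρ, ← expectedTime_eq_iSup]
    exact h.time

end Rename

/-! ### A program that blows up a list of pairs -/

/-- Replace each pair `(x, y)` of `l` by all the pairs `(x * k + i, y * k + j)` with `(i, j)` in
`L`. -/
def blowUp (k : ℕ) (L l : List (ℕ × ℕ)) : List (ℕ × ℕ) :=
  l.flatMap fun e => L.map fun p => (e.1 * k + p.1, e.2 * k + p.2)

theorem length_blowUp (k : ℕ) (L l : List (ℕ × ℕ)) :
    (blowUp k L l).length = l.length * L.length := by
  simp [blowUp, List.length_flatMap]

/-- The store that holds a number, the length of a list of pairs, and the list itself. -/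
def listInput (n : ℕ) (l : List (ℕ × ℕ)) : Store where
  reg r := if r = 0 then n else if r = 1 then l.length else 0
  arr a i := if a = 0 then (l.map Prod.fst).getD i 0
    else if a = 1 then (l.map Prod.snd).getD i 0 else 0

/-- The store `s` agrees with `listInput n l` on the registers and arrays `0` and `1`. -/
structure Holds (n : ℕ) (l : List (ℕ × ℕ)) (s : Store) : Prop where
  reg_zero : s.reg 0 = n
  reg_one : s.reg 1 = l.length
  arr_zero : s.arr 0 = fun i => (l.map Prod.fst).getD i 0
  arr_one : s.arr 1 = fun i => (l.map Prod.snd).getD i 0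

theorem holds_listInput (n : ℕ) (l : List (ℕ × ℕ)) : Holds n l (listInput n l) := by
  constructor <;> simp [listInput]

/-- Since unused cells hold the default `0`, writing at the first free address appends to the list,
and a zero array represents the empty list. -/
theorem update_getD_length {l : List ℕ} (x : ℕ) :
    Function.update (fun i => l.getD i 0) l.length x = fun i => (l ++ [x]).getD i 0 := by
  funext i
  rcases lt_trichotomy i l.length with h | rfl | h
  · rw [Function.update_of_ne h.ne, List.getD_append _ _ _ _ h]
  · simp
  · rw [Function.update_of_ne h.ne', List.getD_eq_default _ _ h.le,
      List.getD_eq_default _ _ (by simpa using h)]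

/-- Append the pairs `(x + i, y + j)` with `(i, j)` in `L` to the arrays `a` and `b`, where `x` and
`y` are in registers `6` and `7`, the next free address is in register `5`, and register `3`
holds `1`. -/
def emitPairs (a b : ℕ) : List (ℕ × ℕ) → Code → Code
  | [], next => next
  | p :: L, next =>
    .instr (.const 8 p.1) <| .instr (.bin .add 8 6 8) <| .instr (.store a 5 8) <|
    .instr (.const 8 p.2) <| .instr (.bin .add 8 7 8) <| .instr (.store b 5 8) <|
    .instr (.bin .add 5 5 3) <| emitPairs a b L next

/-- The main loop of `blowUpCode`. -/
def blowUpBody (a b : ℕ) (L : List (ℕ × ℕ)) : Code :=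
  .instr (.load 6 0 2) <| .instr (.load 7 1 2) <|
  .instr (.bin .mul 6 6 4) <| .instr (.bin .mul 7 7 4) <|
  emitPairs a b L <| .instr (.bin .add 2 2 3) .halt

/-- Write `listInput (n * k) (blowUp k L l)` to the registers and arrays `a` and `b`, given
`listInput n l`. -/
def blowUpCode (a b k : ℕ) (L : List (ℕ × ℕ)) : Code :=
  .instr (.const 2 0) <| .instr (.const 3 1) <| .instr (.const 4 k) <| .instr (.const 5 0) <|
  .whileLt 2 1 (blowUpBody a b L) <|
  .instr (.bin .mul a 0 4) <| .instr (.const 8 0) <| .instr (.bin .add b 5 8) .halt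

/-- The invariant of the loops of `blowUpCode`: `i` input pairs have been read, `out` has been
written, and the initial store was `s₀`. -/
structure BlowUpInv (a b k i : ℕ) (out : List (ℕ × ℕ)) (s₀ s : Store) : Prop where
  reg0 : s.reg 0 = s₀.reg 0
  reg1 : s.reg 1 = s₀.reg 1
  reg2 : s.reg 2 = i
  reg3 : s.reg 3 = 1
  reg4 : s.reg 4 = k
  reg5 : s.reg 5 = out.length
  reg_ge : ∀ r, 10 ≤ r → s.reg r = s₀.reg r
  arr_a : s.arr a = fun j => (out.map Prod.fst).getD j 0
  arr_b : s.arr b = fun j => (out.map Prod.snd).getD j 0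
  arr_ne : ∀ c, c ≠ a → c ≠ b → s.arr c = s₀.arr c

theorem BlowUpInv.setReg {a b k i d v : ℕ} {out : List (ℕ × ℕ)} {s₀ s : Store}
    (h : BlowUpInv a b k i out s₀ s) (h₁ : 6 ≤ d) (h₂ : d < 10) :
    BlowUpInv a b k i out s₀ (s.setReg d v) := by
  have key : ∀ r, r < 6 ∨ 10 ≤ r → (s.setReg d v).reg r = s.reg r := fun r hr => by
    simp only [Store.setReg]
    exact Function.update_of_ne (by omega) _ _
  constructor
  · rw [key _ (by omega), h.reg0]
  · rw [key _ (by omega), h.reg1]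
  · rw [key _ (by omega), h.reg2]
  · rw [key _ (by omega), h.reg3]
  · rw [key _ (by omega), h.reg4]
  · rw [key _ (by omega), h.reg5]
  · intro r hr
    rw [key _ (by omega), h.reg_ge r hr]
  · exact h.arr_a
  · exact h.arr_b
  · exact h.arr_ne

theorem BlowUpInv.emit {a b k i x y v : ℕ} {out : List (ℕ × ℕ)} {s₀ s : Store}
    (hab : a ≠ b) (h : BlowUpInv a b k i out s₀ s) (hv : v = out.length + 1) :
    BlowUpInv a b k i (out ++ [(x, y)]) s₀
      (((s.setArr a out.length x).setArr b out.length y).setReg 5 v) := by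
  have key : ∀ r, r ≠ 5 →
      (((s.setArr a out.length x).setArr b out.length y).setReg 5 v).reg r = s.reg r :=
    fun r hr => by
      simp only [Store.setReg]
      exact Function.update_of_ne hr _ _
  constructor
  · rw [key _ (by omega), h.reg0]
  · rw [key _ (by omega), h.reg1]
  · rw [key _ (by omega), h.reg2]
  · rw [key _ (by omega), h.reg3]
  · rw [key _ (by omega), h.reg4]
  · simp [Store.setReg, hv]
  · intro r hr
    rw [key _ (by omega), h.reg_ge r hr]
  · simp only [Store.setReg, Store.setArr]
    rw [Function.update_of_ne hab, Function.update_self, h.arr_a]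
    have := update_getD_length (l := out.map Prod.fst) x
    rw [List.length_map] at this
    rw [this, List.map_append]
    rfl
  · simp only [Store.setReg, Store.setArr]
    rw [Function.update_self, Function.update_of_ne hab.symm, h.arr_b]
    have := update_getD_length (l := out.map Prod.snd) y
    rw [List.length_map] at this
    rw [this, List.map_append]
    rfl
  · intro c hca hcb
    simp only [Store.setReg, Store.setArr]
    rw [Function.update_of_ne hcb, Function.update_of_ne hca, h.arr_ne c hca hcb]

theorem ensures_emitPairs {w a b k i x y K : ℕ} {L : List (ℕ × ℕ)} {next : Code}
    {s₀ : Store} {Q : Store → Prop} (hab : a ≠ b)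
    (hL : ∀ p ∈ L, x + p.1 < 2 ^ w ∧ y + p.2 < 2 ^ w) {out : List (ℕ × ℕ)} {s : Store}
    (hout : out.length + L.length < 2 ^ w)
    (hs : BlowUpInv a b k i out s₀ s) (hx : s.reg 6 = x) (hy : s.reg 7 = y)
    (hnext : ∀ t, BlowUpInv a b k i (out ++ L.map fun p => (x + p.1, y + p.2)) s₀ t →
      Ensures w next t K Q) :
    Ensures w (emitPairs a b L next) s (7 * L.length + K) Q := by
  induction L generalizing out s with
  | nil => simpa [emitPairs] using hnext s (by simpa using hs)
  | cons p L ih =>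
    have hp := hL p (by simp)
    rw [List.length_cons] at hout ⊢
    have h5 := hs.reg5
    have h3 := hs.reg3
    refine Ensures.mono (K := 7 * L.length + K + 1 + 1 + 1 + 1 + 1 + 1 + 1) ?_ (by omega)
      fun _ h => h
    refine ensures_const (by omega) <| ensures_bin (by simp [BinOp.eval, Store.setReg]; omega) <|
      ensures_store <| ensures_const (by omega) <|
      ensures_bin (by simp [BinOp.eval, Store.setReg, Store.setArr]; omega) <| ensures_store <|
      ensures_bin (by simp [BinOp.eval, Store.setReg, Store.setArr]; omega) ?_
    have key := ((((hs.setReg (d := 8) (v := p.1) (by norm_num) (by norm_num)).setReg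
      (d := 8) (v := x + p.1) (by norm_num) (by norm_num)).setReg
      (d := 8) (v := p.2) (by norm_num) (by norm_num)).setReg
      (d := 8) (v := y + p.2) (by norm_num) (by norm_num)).emit (x := x + p.1) (y := y + p.2)
        hab rfl
    refine ih (out := out ++ [(x + p.1, y + p.2)]) (fun q hq => hL q (by simp [hq]))
      (by simp; omega) ?_ ?_ ?_ (by simpa using hnext)
    · convert key using 1
      simp [Store.setReg, Store.setArr, BinOp.eval, h5, h3, hx, hy]
    · simp [Store.setReg, Store.setArr, hx]
    · simp [Store.setReg, Store.setArr, hy]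

theorem ensures_blowUpBody {w a b n k i : ℕ} {L l : List (ℕ × ℕ)} {s₀ : Store}
    (ha : 10 ≤ a) (hb : 10 ≤ b) (hab : a ≠ b) (hs₀ : Holds n l s₀)
    (hl : ∀ e ∈ l, e.1 < n ∧ e.2 < n) (hL : ∀ p ∈ L, p.1 < k ∧ p.2 < k)
    (hnk : n * k < 2 ^ w) (hlw : l.length < 2 ^ w) (hlLw : l.length * L.length < 2 ^ w)
    (hi : i < l.length) {s : Store} (hs : BlowUpInv a b k i (blowUp k L (l.take i)) s₀ s) :
    Ensures w (blowUpBody a b L) s (7 * L.length + 5)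
      (BlowUpInv a b k (i + 1) (blowUp k L (l.take (i + 1))) s₀) := by
  have h2 := hs.reg2
  have h3 := hs.reg3
  have h4 := hs.reg4
  have hlt := hl l[i] (List.getElem_mem hi)
  have hx : s.arr 0 i = l[i].1 := by
    rw [hs.arr_ne 0 (by omega) (by omega), hs₀.arr_zero]
    simp [hi]
  have hy : s.arr 1 i = l[i].2 := by
    rw [hs.arr_ne 1 (by omega) (by omega), hs₀.arr_one]
    simp [hi]
  have hxw : l[i].1 * k ≤ n * k := Nat.mul_le_mul_right _ hlt.1.le
  have hyw : l[i].2 * k ≤ n * k := Nat.mul_le_mul_right _ hlt.2.le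
  -- A new vertex name is below `(x + 1) * k ≤ n * k`.
  have hadd : ∀ x p : ℕ, x < n → p < k → x * k + p < 2 ^ w := fun x p hx hp => by
    have : (x + 1) * k ≤ n * k := Nat.mul_le_mul_right _ hx
    rw [add_one_mul] at this
    omega
  have htake : blowUp k L (l.take (i + 1)) =
      blowUp k L (l.take i) ++ L.map fun p => (l[i].1 * k + p.1, l[i].2 * k + p.2) := by
    rw [blowUp, blowUp, List.take_succ_eq_append_getElem hi, List.flatMap_append]
    simp
  refine Ensures.mono (K := 7 * L.length + (0 + 1) + 1 + 1 + 1 + 1) ?_ (by omega) fun _ h => h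
  refine ensures_load <| ensures_load <|
    ensures_bin (by simp [BinOp.eval, Store.setReg, h2, h4, hx]; omega) <|
    ensures_bin (by simp [BinOp.eval, Store.setReg, h2, h4, hy]; omega) <|
    ensures_emitPairs (x := l[i].1 * k) (y := l[i].2 * k) (out := blowUp k L (l.take i))
      (s₀ := s₀) (k := k) (i := i) hab
      (fun p hp => ⟨hadd _ _ hlt.1 (hL p hp).1, hadd _ _ hlt.2 (hL p hp).2⟩) ?_ ?_ ?_ ?_ ?_
  · rw [length_blowUp, ← add_one_mul]
    refine lt_of_le_of_lt (Nat.mul_le_mul_right _ ?_) hlLw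
    simp; omega
  · exact (((hs.setReg (by norm_num) (by norm_num)).setReg (by norm_num) (by norm_num)).setReg
      (by norm_num) (by norm_num)).setReg (by norm_num) (by norm_num)
  · simp [BinOp.eval, Store.setReg, h2, h4, hx]
  · simp [BinOp.eval, Store.setReg, h2, h4, hy]
  · intro t ht
    rw [← htake] at ht
    have h2' := ht.reg2
    have h3' := ht.reg3
    refine ensures_bin (by simp [BinOp.eval, h2', h3']; omega) (ensures_halt ?_)
    have key : ∀ r v, r ≠ 2 → (t.setReg 2 v).reg r = t.reg r := fun r v hr => by
      simp only [Store.setReg]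
      exact Function.update_of_ne hr _ _
    constructor
    · rw [key _ _ (by omega), ht.reg0]
    · rw [key _ _ (by omega), ht.reg1]
    · simp [Store.setReg, BinOp.eval, h2', h3']
    · rw [key _ _ (by omega), ht.reg3]
    · rw [key _ _ (by omega), ht.reg4]
    · rw [key _ _ (by omega), ht.reg5]
    · intro r hr
      rw [key _ _ (by omega), ht.reg_ge r hr]
    · exact ht.arr_a
    · exact ht.arr_b
    · exact ht.arr_ne

/-- The effect of `blowUpCode`, started in `s`. -/
structure BlownUp (a b n : ℕ) (out : List (ℕ × ℕ)) (s t : Store) : Prop where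
  reg0 : t.reg 0 = s.reg 0
  reg1 : t.reg 1 = s.reg 1
  reg_a : t.reg a = n
  reg_b : t.reg b = out.length
  reg_ne : ∀ r, 10 ≤ r → r ≠ a → r ≠ b → t.reg r = s.reg r
  arr_a : t.arr a = fun j => (out.map Prod.fst).getD j 0
  arr_b : t.arr b = fun j => (out.map Prod.snd).getD j 0
  arr_ne : ∀ c, c ≠ a → c ≠ b → t.arr c = s.arr c

theorem ensures_blowUpCode {w a b n k : ℕ} {L l : List (ℕ × ℕ)} {s : Store}
    (ha : 10 ≤ a) (hb : 10 ≤ b) (hab : a ≠ b) (hs : Holds n l s)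
    (hsa : s.arr a = 0) (hsb : s.arr b = 0)
    (hl : ∀ e ∈ l, e.1 < n ∧ e.2 < n) (hL : ∀ p ∈ L, p.1 < k ∧ p.2 < k)
    (h1 : 1 < 2 ^ w) (hk : k < 2 ^ w)
    (hnk : n * k < 2 ^ w) (hlw : l.length < 2 ^ w) (hlLw : l.length * L.length < 2 ^ w) :
    Ensures w (blowUpCode a b k L) s (l.length * (7 * L.length + 6) + 8)
      (BlownUp a b (n * k) (blowUp k L l) s) := by
  have hs1 := hs.reg_one
  refine Ensures.mono (K := l.length * (7 * L.length + 5 + 1) + (0 + 1 + 1 + 1) + 1 + 1 + 1 + 1 + 1)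
    ?_ (le_of_eq (by ring)) fun _ h => h
  refine ensures_const (by omega) <| ensures_const h1 <| ensures_const hk <|
    ensures_const (by omega) <|
    ensures_whileLt (N := l.length) (fun i => BlowUpInv a b k i (blowUp k L (l.take i)) s)
      (fun i hi t ht => ⟨?_, ensures_blowUpBody ha hb hab hs hl hL hnk hlw hlLw hi ht⟩)
      (fun t ht => ⟨?_, ?_⟩) ?_
  · rw [ht.reg1, ht.reg2, hs1]
    exact hi
  · rw [ht.reg1, ht.reg2, hs1]
    exact lt_irrefl _
  · have h0 := ht.reg0
    have h4 := ht.reg4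
    have h5 := ht.reg5
    have hs0 := hs.reg_zero
    simp only [List.take_length] at ht h5
    have hlen : (blowUp k L l).length < 2 ^ w := by rwa [length_blowUp]
    -- The addition of a zero register copies the output length into register `b`.
    refine ensures_bin (by simpa [BinOp.eval, h0, h4, hs0] using hnk) <|
      ensures_const (by omega) <| ensures_bin ?_ <| ensures_halt ?_
    · simp only [BinOp.eval, Store.setReg]
      rw [Function.update_of_ne (by omega), Function.update_of_ne (by omega),
        Function.update_self, h5]
      exact hlen
    · constructor
      · simp only [BinOp.eval, Store.setReg]
        rw [Function.update_of_ne (by omega), Function.update_of_ne (by omega),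
          Function.update_of_ne (by omega), h0]
      · simp only [BinOp.eval, Store.setReg]
        rw [Function.update_of_ne (by omega), Function.update_of_ne (by omega),
          Function.update_of_ne (by omega), ht.reg1]
      · simp only [BinOp.eval, Store.setReg]
        rw [Function.update_of_ne (by omega), Function.update_of_ne (by omega),
          Function.update_self, h0, h4, hs0]
      · simp only [BinOp.eval, Store.setReg]
        rw [Function.update_self, Function.update_of_ne (by omega),
          Function.update_of_ne (by omega), Function.update_self, h5, add_zero]
      · intro r hr hra hrb
        simp only [BinOp.eval, Store.setReg]
        rw [Function.update_of_ne (by omega), Function.update_of_ne (by omega),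
          Function.update_of_ne (by omega), ht.reg_ge r hr]
      · exact ht.arr_a
      · exact ht.arr_b
      · exact ht.arr_ne
  · constructor
    any_goals simp [Store.setReg, blowUp]
    · intro r hr
      rw [Function.update_of_ne (by omega), Function.update_of_ne (by omega),
        Function.update_of_ne (by omega), Function.update_of_ne (by omega)]
    · exact hsa
    · exact hsb

/-! ### Calling a program on a blown-up input -/

/-- Two disjoint families of names, both disjoint from `{0, …, 9}`. -/
def bank (j r : ℕ) : ℕ := 2 * r + 10 + j

theorem bank_injective (j : ℕ) : Function.Injective (bank j) := fun r r' h => by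
  simp only [bank] at h
  omega

/-- Blow up the input and run the program `A` on the result, in the `j`-th bank. -/
def callCode (j k : ℕ) (L : List (ℕ × ℕ)) (A : Code) : Code :=
  (blowUpCode (bank j 0) (bank j 1) k L).append (A.rename (bank j))

theorem ensures_callCode {w j n k K : ℕ} {L l : List (ℕ × ℕ)} {A : Code} {s : Store}
    {Q : Store → Prop} (hs : Holds n l s)
    (hbank : ∀ r, s.reg (bank j r) = 0 ∧ s.arr (bank j r) = 0)
    (hl : ∀ e ∈ l, e.1 < n ∧ e.2 < n) (hL : ∀ p ∈ L, p.1 < k ∧ p.2 < k)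
    (h1 : 1 < 2 ^ w) (hk : k < 2 ^ w)
    (hnk : n * k < 2 ^ w) (hlw : l.length < 2 ^ w) (hlLw : l.length * L.length < 2 ^ w)
    (hA : Ensures w A (listInput (n * k) (blowUp k L l)) K Q) :
    Ensures w (callCode j k L A) s (l.length * (7 * L.length + 6) + 8 + K) fun t =>
      Holds n l t ∧ (∃ s', Q s' ∧ t.reg (bank j 0) = s'.reg 0) ∧
        ∀ x, 10 ≤ x → x ∉ Set.range (bank j) → t.reg x = s.reg x ∧ t.arr x = s.arr x := by
  have h0 := ensures_blowUpCode (a := bank j 0) (b := bank j 1) (by simp [bank])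
    (by simp only [bank]; omega) (by simp [bank]) hs (hbank 0).2 (hbank 1).2 hl hL h1 hk hnk hlw hlLw
  refine h0.append fun t ht => ?_
  -- The rest of the bank is still zero, so seen through `bank j` the store is exactly a fresh input
  -- for `A`.
  have hemb : t = Store.embed (bank j) t (listInput (n * k) (blowUp k L l)) := by
    ext x
    · by_cases hx : x ∈ Set.range (bank j)
      · obtain ⟨r, rfl⟩ := hx
        rw [Store.embed_reg (bank_injective j)]
        match r with
        | 0 => rw [ht.reg_a]; simp [listInput]
        | 1 => rw [ht.reg_b]; simp [listInput]
        | r + 2 =>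
          rw [ht.reg_ne _ (by simp only [bank]; omega) (by simp [bank])
            (by simp only [bank]; omega),
            (hbank _).1]
          simp [listInput]
      · exact (Function.extend_apply' _ _ _ (by simpa using hx)).symm
    · by_cases hx : x ∈ Set.range (bank j)
      · obtain ⟨r, rfl⟩ := hx
        rw [Store.embed_arr (bank_injective j)]
        match r with
        | 0 => rw [ht.arr_a]; simp [listInput]
        | 1 => rw [ht.arr_b]; simp [listInput]
        | r + 2 =>
          rw [ht.arr_ne _ (by simp [bank]) (by simp only [bank]; omega), (hbank _).2]
          simp [listInput]
      · exact congrFun (Function.extend_apply' _ _ _ (by simpa using hx)).symm _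
  have h2 := hA.rename (bank_injective j) t
  rw [← hemb] at h2
  refine h2.mono le_rfl ?_
  rintro t' ⟨s', hs', rfl⟩
  have hreg : ∀ x, x ∉ Set.range (bank j) → (Store.embed (bank j) t s').reg x = t.reg x :=
    fun x hx => Function.extend_apply' _ _ _ (by simpa using hx)
  have harr : ∀ x, x ∉ Set.range (bank j) → (Store.embed (bank j) t s').arr x = t.arr x :=
    fun x hx => Function.extend_apply' _ _ _ (by simpa using hx)
  have hlow : ∀ x, x < 10 → x ∉ Set.range (bank j) := by
    rintro x hx ⟨r, rfl⟩
    simp only [bank] at hx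
    omega
  have hne : ∀ x r, x ∉ Set.range (bank j) → x ≠ bank j r := fun x r hx h => hx ⟨r, h.symm⟩
  refine ⟨⟨?_, ?_, ?_, ?_⟩, ⟨s', hs', Store.embed_reg (bank_injective j) t s' 0⟩, ?_⟩
  · rw [hreg 0 (hlow 0 (by norm_num)), ht.reg0, hs.reg_zero]
  · rw [hreg 1 (hlow 1 (by norm_num)), ht.reg1, hs.reg_one]
  · rw [harr 0 (hlow 0 (by norm_num)), ht.arr_ne _ (hne _ _ (hlow 0 (by norm_num)))
      (hne _ _ (hlow 0 (by norm_num))), hs.arr_zero]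
  · rw [harr 1 (hlow 1 (by norm_num)), ht.arr_ne _ (hne _ _ (hlow 1 (by norm_num)))
      (hne _ _ (hlow 1 (by norm_num))), hs.arr_one]
  · intro x hx hxr
    rw [hreg x hxr, harr x hxr]
    exact ⟨ht.reg_ne x hx (hne _ _ hxr) (hne _ _ hxr), ht.arr_ne x (hne _ _ hxr) (hne _ _ hxr)⟩

end WordRAM

/-! ### Tensor products and the algebra of easy problems -/

namespace SubgraphCounting

open WordRAM

/-! ### Tensor products -/

/-- The tensor product of a simple graph on `Fin n` and a graph, possibly with loops, on `Fin k`. -/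
def tensor {n k : ℕ} (G : SimpleGraph (Fin n)) (F : LoopGraph (Fin k)) :
    SimpleGraph (Fin (n * k)) where
  Adj x y := G.Adj (finProdFinEquiv.symm x).1 (finProdFinEquiv.symm y).1 ∧
    F.Adj (finProdFinEquiv.symm x).2 (finProdFinEquiv.symm y).2
  symm := ⟨fun _ _ h => ⟨h.1.symm, F.symm h.2⟩⟩
  loopless := ⟨fun _ h => h.1.ne rfl⟩

/-- Order the pairs lexicographically, first coordinates by `v`. Neighbours differ in the first
coordinate because `G` has no loops, so a later neighbour of `(i, a)` has one of at most `κ` first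
coordinates and any second one. -/
theorem IsDegenerate.tensor {κ n k : ℕ} {G : SimpleGraph (Fin n)} (hG : IsDegenerate κ G)
    (F : LoopGraph (Fin k)) : IsDegenerate (κ * k) (tensor G F) := by
  obtain ⟨v, hv⟩ := hG
  refine ⟨finProdFinEquiv.symm.trans ((v.prodCongr (Equiv.refl _)).trans finProdFinEquiv),
    fun x => ?_⟩
  obtain ⟨⟨i, a⟩, rfl⟩ := finProdFinEquiv.surjective x
  calc _ ≤ (finProdFinEquiv '' ({j | i < j ∧ G.Adj (v i) (v j)} ×ˢ
        (Set.univ : Set (Fin k)))).ncard := by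
        refine Set.ncard_le_ncard ?_ (Set.toFinite _)
        rintro y ⟨hlt, hadj⟩
        obtain ⟨⟨j, c⟩, rfl⟩ := finProdFinEquiv.surjective y
        simp only [SubgraphCounting.tensor, Equiv.trans_apply, Equiv.symm_apply_apply,
          Equiv.prodCongr_apply, Prod.map_apply, Equiv.refl_apply] at hadj
        refine ⟨(j, c), ⟨⟨?_, hadj.1⟩, trivial⟩, rfl⟩
        have hne : (i : ℕ) ≠ j := fun h => hadj.1.ne (congrArg v (Fin.ext h))
        rw [Fin.lt_def] at hlt ⊢
        simp only [finProdFinEquiv_apply_val] at hlt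
        by_contra hcon
        change ¬ ((i : ℕ) < j) at hcon
        have h1 : (j : ℕ) + 1 ≤ i := by omega
        have h2 := Nat.mul_le_mul_left k h1
        rw [mul_add] at h2
        have := c.2
        omega
    _ ≤ _ := Set.ncard_image_le (Set.toFinite _)
    _ ≤ κ * k := by
        rw [Set.ncard_prod, Set.ncard_univ, Nat.card_fin]
        exact Nat.mul_le_mul_right _ (hv i)

/-- Yields an edge bound independent of `κ`, as needed for the word length, which must not depend on
`κ`. -/
theorem isDegenerate_self {n : ℕ} (G : SimpleGraph (Fin n)) : IsDegenerate n G :=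
  ⟨1, fun _ => (Set.ncard_le_card _).trans (by simp)⟩

/-- Charge each edge to its earlier endpoint in the degeneracy order. -/
theorem IsEdgeList.length_le {κ n : ℕ} {G : SimpleGraph (Fin n)} {E : List (Fin n × Fin n)}
    (hE : IsEdgeList G E) (hG : IsDegenerate κ G) : E.length ≤ n * κ := by
  classical
  obtain ⟨v, hv⟩ := hG
  rw [← List.length_map (fun e : Fin n × Fin n => s(e.1, e.2)),
    ← List.toFinset_card_of_nodup hE.1]
  calc _ ≤ (Finset.univ.biUnion fun i =>
        ({j | i < j ∧ G.Adj (v i) (v j)} : Finset (Fin n)).image fun j => s(v i, v j)).card := by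
        refine Finset.card_le_card fun z hz => ?_
        induction z using Sym2.ind with | _ x y =>
        rw [List.mem_toFinset, hE.2] at hz
        obtain ⟨i, rfl⟩ := v.surjective x
        obtain ⟨j, rfl⟩ := v.surjective y
        simp only [Finset.mem_biUnion, Finset.mem_univ, true_and, Finset.mem_image,
          Finset.mem_filter]
        rcases lt_trichotomy i j with h | rfl | h
        · exact ⟨i, j, ⟨h, hz⟩, rfl⟩
        · exact absurd rfl hz.ne
        · exact ⟨j, i, ⟨h, hz.symm⟩, Sym2.eq_swap⟩
    _ ≤ _ := Finset.card_biUnion_le_card_mul _ _ κ fun i _ => by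
        refine Finset.card_image_le.trans ?_
        rw [← Set.ncard_coe_finset]
        simpa using hv i
    _ = n * κ := by simp

open Classical in
/-- All pairs of adjacent vertices. -/
noncomputable def LoopGraph.adjList {k : ℕ} (F : LoopGraph (Fin k)) : List (Fin k × Fin k) :=
  ({p | F.Adj p.1 p.2} : Finset (Fin k × Fin k)).toList

/-- The list of the edges of the tensor product. -/
noncomputable def tensorEdges {n k : ℕ} (F : LoopGraph (Fin k)) (E : List (Fin n × Fin n)) :
    List (Fin (n * k) × Fin (n * k)) :=
  (E.product F.adjList).map fun q =>
    (finProdFinEquiv (q.1.1, q.2.1), finProdFinEquiv (q.1.2, q.2.2))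

theorem LoopGraph.mem_adjList {k : ℕ} {F : LoopGraph (Fin k)} {p : Fin k × Fin k} :
    p ∈ F.adjList ↔ F.Adj p.1 p.2 := by simp [adjList]

theorem LoopGraph.nodup_adjList {k : ℕ} (F : LoopGraph (Fin k)) : F.adjList.Nodup :=
  Finset.nodup_toList _

theorem LoopGraph.length_adjList_le {k : ℕ} (F : LoopGraph (Fin k)) :
    F.adjList.length ≤ k * k := by
  refine F.nodup_adjList.length_le_card.trans ?_
  simp

theorem IsEdgeList.adj {n : ℕ} {G : SimpleGraph (Fin n)} {E : List (Fin n × Fin n)}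
    (hE : IsEdgeList G E) {e : Fin n × Fin n} (he : e ∈ E) : G.Adj e.1 e.2 :=
  (hE.2 _ _).1 (List.mem_map_of_mem (f := fun e : Fin n × Fin n => s(e.1, e.2)) he)

/-- One orientation of each edge of `G` is combined with all ordered adjacent pairs of `F`;
reversing the former is the same as reversing the latter. -/
theorem IsEdgeList.tensor {n k : ℕ} {G : SimpleGraph (Fin n)} {E : List (Fin n × Fin n)}
    (hE : IsEdgeList G E) (F : LoopGraph (Fin k)) :
    IsEdgeList (tensor G F) (tensorEdges F E) := by
  constructor
  · rw [tensorEdges, List.map_map]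
    refine List.Nodup.map_on ?_ (hE.1.of_map.product F.nodup_adjList)
    rintro ⟨⟨u, v⟩, i, j⟩ h ⟨⟨u', v'⟩, i', j'⟩ h' heq
    rw [List.pair_mem_product] at h h'
    simp only [Function.comp_apply, Sym2.eq_iff, EmbeddingLike.apply_eq_iff_eq,
      Prod.mk.injEq] at heq
    rcases heq with ⟨⟨rfl, rfl⟩, rfl, rfl⟩ | ⟨⟨rfl, rfl⟩, rfl, rfl⟩
    · rfl
    · have := List.inj_on_of_nodup_map hE.1 h.1 h'.1 Sym2.eq_swap
      simp only [Prod.mk.injEq] at this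
      exact absurd this.1 (hE.adj h.1).ne
  · intro x y
    obtain ⟨⟨u, i⟩, rfl⟩ := finProdFinEquiv.surjective x
    obtain ⟨⟨v, j⟩, rfl⟩ := finProdFinEquiv.surjective y
    simp only [tensorEdges, List.map_map, List.mem_map, Prod.exists, List.pair_mem_product,
      LoopGraph.mem_adjList, Function.comp_apply, Sym2.eq_iff, EmbeddingLike.apply_eq_iff_eq,
      Prod.mk.injEq, SubgraphCounting.tensor, Equiv.symm_apply_apply]
    constructor
    · rintro ⟨a, b, c, d, ⟨hab, hcd⟩, ⟨⟨rfl, rfl⟩, rfl, rfl⟩ | ⟨⟨rfl, rfl⟩, rfl, rfl⟩⟩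
      · exact ⟨hE.adj hab, hcd⟩
      · exact ⟨(hE.adj hab).symm, F.symm hcd⟩
    · rintro ⟨h₁, h₂⟩
      have := (hE.2 u v).2 h₁
      simp only [List.mem_map, Prod.exists, Sym2.eq_iff] at this
      obtain ⟨a, b, hab, ⟨rfl, rfl⟩ | ⟨rfl, rfl⟩⟩ := this
      · exact ⟨a, b, i, j, ⟨hab, h₂⟩, .inl ⟨⟨rfl, rfl⟩, rfl, rfl⟩⟩
      · exact ⟨a, b, j, i, ⟨hab, F.symm h₂⟩, .inr ⟨⟨rfl, rfl⟩, rfl, rfl⟩⟩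

/-- Forget the bounds. -/
def natPairs {n : ℕ} (E : List (Fin n × Fin n)) : List (ℕ × ℕ) :=
  E.map fun e => ((e.1 : ℕ), (e.2 : ℕ))

theorem input_eq_listInput {n : ℕ} (E : List (Fin n × Fin n)) :
    input n E = listInput n (natPairs E) := by
  simp [input, listInput, natPairs, Function.comp_def]

theorem natPairs_lt {n : ℕ} {E : List (Fin n × Fin n)} {e : ℕ × ℕ} (he : e ∈ natPairs E) :
    e.1 < n ∧ e.2 < n := by
  simp only [natPairs, List.mem_map] at he
  obtain ⟨e, _, rfl⟩ := he
  exact ⟨e.1.2, e.2.2⟩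

theorem natPairs_tensorEdges {n k : ℕ} (F : LoopGraph (Fin k)) (E : List (Fin n × Fin n)) :
    natPairs (tensorEdges F E) = blowUp k (natPairs F.adjList) (natPairs E) := by
  simp only [natPairs, tensorEdges, blowUp, List.product, List.map_flatMap,
    List.map_map, List.flatMap_map, Function.comp_def, finProdFinEquiv_apply_val]
  refine congrArg (fun f => List.flatMap f E) (funext fun e => ?_)
  refine congrArg (fun f => List.map f _) (funext fun p => ?_)
  rw [add_comm, mul_comm, add_comm (p.2 : ℕ), mul_comm k]

/-! ### Closure properties of easy problems -/

theorem lt_two_pow_log_succ (n : ℕ) : n < 2 ^ (Nat.log 2 n + 1) :=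
  Nat.lt_pow_succ_log_self (by norm_num) n

theorem isEasy_const (c : ℕ) : IsEasy fun _ _ => c := by
  refine ⟨.instr (.const 0 c) .halt, c + 1, fun _ => 1, fun κ n hn G _ E _ => ensures_iff.2 ?_⟩
  refine Ensures.mono (K := 0 + 1) (Q := fun t => t.reg 0 = c) ?_
    (show 0 + 1 ≤ 1 * n by omega) fun _ h => h
  refine ensures_const ?_ (ensures_halt (by simp [Store.setReg]))
  refine Nat.lt_two_pow_self.trans_le (Nat.pow_le_pow_right (by norm_num) ?_)
  nlinarith

/-- An easy problem can be solved on the tensor product of the input with a fixed graph by a piece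
of code that keeps the input. -/
theorem IsEasy.exists_call {cnt : ∀ n : ℕ, SimpleGraph (Fin n) → ℕ} (h : IsEasy cnt) {k : ℕ}
    (hk : 1 ≤ k) (F : LoopGraph (Fin k)) :
    ∃ (C : ℕ → Code) (b : ℕ) (f : ℕ → ℕ),
      ∀ (κ n : ℕ), 1 ≤ n → ∀ G : SimpleGraph (Fin n), IsDegenerate κ G →
        ∀ E : List (Fin n × Fin n), IsEdgeList G E →
          ∀ (j w : ℕ) (s : Store), b * (Nat.log 2 n + 1) ≤ w → Holds n (natPairs E) s →
            (∀ r, s.reg (bank j r) = 0 ∧ s.arr (bank j r) = 0) →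
            Ensures w (C j) s (f κ * n) fun t =>
              Holds n (natPairs E) t ∧ t.reg (bank j 0) = cnt (n * k) (SubgraphCounting.tensor G F) ∧
              ∀ x, 10 ≤ x → x ∉ Set.range (bank j) → t.reg x = s.reg x ∧ t.arr x = s.arr x := by
  obtain ⟨A, b, f, hA⟩ := h
  -- With `X = log n + 1`, running `A` on `n * k` vertices takes words of `b * (X + k)` bits, and
  -- the length of the new edge list is below `2 ^ (2 * X + 2 * k)`. In the time bound, each of at
  -- most `κ * n` edges yields at most `k * k` new ones, and `A` is charged for degeneracy `κ * k`.
  refine ⟨fun j => callCode j k (natPairs F.adjList) A, b * (k + 1) + 2 * k + 2,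
    fun κ => κ * (7 * (k * k) + 6) + 8 + f (κ * k) * k, ?_⟩
  intro κ n hn G hG E hE j w s hw hs hbank
  set X := Nat.log 2 n + 1 with hX
  have hXpos : 1 ≤ X := by omega
  have hnX : n < 2 ^ X := lt_two_pow_log_succ n
  have hkk : k < 2 ^ k := Nat.lt_two_pow_self
  have hw' : b * (X + k) + 2 * X + 2 * k ≤ w := by
    refine le_trans ?_ hw
    have h1 : k ≤ k * X := Nat.le_mul_of_pos_right _ hXpos
    have h2 := Nat.mul_le_mul_left b h1
    nlinarith
  have hpow : ∀ a m, m < 2 ^ a → a ≤ w → m < 2 ^ w := fun a m h1 h2 =>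
    h1.trans_le (Nat.pow_le_pow_right (by norm_num) h2)
  have hnk : n * k < 2 ^ (X + k) := by
    rw [pow_add]
    exact Nat.mul_lt_mul'' hnX hkk
  have hlen : E.length < 2 ^ (2 * X) := by
    refine (hE.length_le (isDegenerate_self G)).trans_lt ?_
    rw [two_mul, pow_add]
    exact Nat.mul_lt_mul'' hnX hnX
  have hLlen : F.adjList.length < 2 ^ (2 * k) := by
    refine F.length_adjList_le.trans_lt ?_
    rw [two_mul, pow_add]
    exact Nat.mul_lt_mul'' hkk hkk
  have hlog : Nat.log 2 (n * k) + 1 ≤ X + k :=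
    Nat.log_lt_of_lt_pow (by positivity) hnk
  have hrun := ensures_iff.1 (hA (κ * k) (n * k) (Nat.mul_pos hn hk) (SubgraphCounting.tensor G F)
    (hG.tensor F) (tensorEdges F E) (hE.tensor F))
  rw [input_eq_listInput, natPairs_tensorEdges] at hrun
  have hbw : b * (Nat.log 2 (n * k) + 1) ≤ w :=
    (Nat.mul_le_mul_left b hlog).trans (by omega)
  have hcall := ensures_callCode (j := j) hs hbank (fun e he => natPairs_lt he)
    (fun p hp => natPairs_lt hp) (hpow 1 1 (by norm_num) (by omega)) (hpow k k hkk (by omega))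
    (hpow _ _ hnk (by omega)) (hpow _ _ (by simpa [natPairs] using hlen) (by omega))
    (hpow (2 * X + 2 * k) _ (by
      rw [pow_add]
      simpa [natPairs] using Nat.mul_lt_mul'' hlen hLlen) (by omega)) (hrun.of_le hbw)
  refine hcall.mono ?_ ?_
  · simp only [natPairs, List.length_map]
    have h1 := hE.length_le hG
    have h2 := Nat.mul_le_mul h1 (show 7 * F.adjList.length + 6 ≤ 7 * (k * k) + 6 by
      have := F.length_adjList_le
      omega)
    nlinarith
  · rintro t ⟨h1, ⟨s', h2, h3⟩, h4⟩
    exact ⟨h1, h3.trans h2, h4⟩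

theorem input_bank {n : ℕ} (E : List (Fin n × Fin n)) (j r : ℕ) :
    (input n E).reg (bank j r) = 0 ∧ (input n E).arr (bank j r) = 0 := by
  have h0 : bank j r ≠ 0 := by simp only [bank]; omega
  have h1 : bank j r ≠ 1 := by simp only [bank]; omega
  constructor
  · simp [input, h0, h1]
  · funext i
    simp [input, h0, h1]

theorem IsEasy.tensor {cnt : ∀ n : ℕ, SimpleGraph (Fin n) → ℕ} (h : IsEasy cnt) {k : ℕ}
    (F : LoopGraph (Fin k)) : IsEasy fun n G => cnt (n * k) (SubgraphCounting.tensor G F) := by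
  rcases Nat.eq_zero_or_pos k with rfl | hk
  -- For `k = 0` the product has no vertices, where easiness of `cnt` says nothing; but then the
  -- answer is constant.
  · convert isEasy_const (cnt 0 ⊥) using 3 with n G
    exact congrArg (cnt 0) (SimpleGraph.ext (funext fun x => Fin.elim0 x))
  obtain ⟨C, b, f, hC⟩ := h.exists_call hk F
  -- The result in register `10 = bank 0 0` is moved through a memory cell: unlike arithmetic, this
  -- needs no proof that it fits into a word.
  refine ⟨(C 0).append (.instr (.store 2 2 10) (.instr (.load 0 2 2) .halt)), b,
    fun κ => f κ + 2, fun κ n hn G hG E hE => ensures_iff.2 ?_⟩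
  have h0 := hC κ n hn G hG E hE 0 _ (input n E) le_rfl
    (input_eq_listInput E ▸ holds_listInput _ _) (input_bank E 0)
  refine (h0.append (K' := 0 + 1 + 1) (R := fun t => t.reg 0 = _) ?_).mono (by nlinarith)
    fun _ h => h
  rintro t ⟨-, ht, -⟩
  refine ensures_store (ensures_load (ensures_halt ?_))
  simp only [Store.setReg, Store.setArr, Function.update_self]
  exact ht

/-- The counts are bounded by a polynomial in the number of vertices. -/
def PolyBounded (cnt : ∀ n : ℕ, SimpleGraph (Fin n) → ℕ) : Prop :=
  ∃ d, ∀ n, ∀ G : SimpleGraph (Fin n), cnt n G < 2 ^ (d * (Nat.log 2 n + 1))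

/-- The graph with one vertex and a loop. -/
def loopVertex : LoopGraph (Fin 1) := ⟨fun _ _ => True, fun _ _ h => h⟩

/-- The looped vertex is the unit of the tensor product, so `IsEasy.exists_call` also runs an
algorithm on a copy of `G` itself. The vertex types differ, whence the transport along `n * 1 = n`.
-/
theorem count_tensor_loopVertex (cnt : ∀ n : ℕ, SimpleGraph (Fin n) → ℕ) {n : ℕ}
    (G : SimpleGraph (Fin n)) : cnt (n * 1) (SubgraphCounting.tensor G loopVertex) = cnt n G := by
  have key : ∀ m (h : m = n), cnt m (G.comap (Fin.cast h)) = cnt n G := by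
    rintro m rfl
    rfl
  rw [← key (n * 1) (mul_one n)]
  congr 1
  ext x y
  obtain ⟨⟨u, i⟩, rfl⟩ := finProdFinEquiv.surjective x
  obtain ⟨⟨v, j⟩, rfl⟩ := finProdFinEquiv.surjective y
  have hcast : ∀ (u : Fin n) (i : Fin 1),
      Fin.cast (mul_one n) (finProdFinEquiv (u, i)) = u := fun u i => by
    ext
    simp
  simp only [SubgraphCounting.tensor, loopVertex, SimpleGraph.comap_adj, Equiv.symm_apply_apply,
    hcast, and_true]

/-- The two algorithms run in disjoint banks and leave their results in registers `10` and `11`.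
Polynomial boundedness makes the combined value fit into a word. -/
theorem IsEasy.bin {c₁ c₂ : ∀ n : ℕ, SimpleGraph (Fin n) → ℕ} (h₁ : IsEasy c₁) (h₂ : IsEasy c₂)
    (o : BinOp) (hb : PolyBounded fun n G => o.eval (c₁ n G) (c₂ n G)) :
    IsEasy fun n G => o.eval (c₁ n G) (c₂ n G) := by
  obtain ⟨C₁, b₁, f₁, hC₁⟩ := h₁.exists_call le_rfl loopVertex
  obtain ⟨C₂, b₂, f₂, hC₂⟩ := h₂.exists_call le_rfl loopVertex
  obtain ⟨d, hd⟩ := hb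
  refine ⟨(C₁ 0).append ((C₂ 1).append (.instr (.bin o 0 10 11) .halt)), b₁ + b₂ + d,
    fun κ => f₁ κ + f₂ κ + 1, fun κ n hn G hG E hE => ensures_iff.2 ?_⟩
  have hle : ∀ b, b ≤ b₁ + b₂ + d →
      b * (Nat.log 2 n + 1) ≤ (b₁ + b₂ + d) * (Nat.log 2 n + 1) :=
    fun b hb => Nat.mul_le_mul_right _ hb
  have h0 := hC₁ κ n hn G hG E hE 0 _ (input n E) (hle b₁ (by omega))
    (input_eq_listInput E ▸ holds_listInput _ _) (input_bank E 0)
  refine (h0.append (K' := f₂ κ * n + (0 + 1)) (R := fun t => t.reg 0 = _) ?_).mono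
    (by nlinarith) fun _ h => h
  rintro t ⟨ht, ht10, htne⟩
  have hodd : ∀ r, bank 1 r ∉ Set.range (bank 0) := by
    rintro r ⟨r', hr⟩
    simp only [bank] at hr
    omega
  have h0' := hC₂ κ n hn G hG E hE 1 _ t (hle b₂ (by omega)) ht fun r => by
    rw [(htne _ (by simp only [bank]; omega) (hodd r)).1,
      (htne _ (by simp only [bank]; omega) (hodd r)).2]
    exact input_bank E 1 r
  refine h0'.append ?_
  rintro t' ⟨-, ht11, ht'ne⟩
  have e10 : t'.reg 10 = c₁ n G := by
    rw [(ht'ne 10 le_rfl (by rintro ⟨r, hr⟩; simp only [bank] at hr; omega)).1,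
      ← count_tensor_loopVertex c₁ G]
    exact ht10
  have e11 : t'.reg 11 = c₂ n G := by
    rw [← count_tensor_loopVertex c₂ G]
    exact ht11
  refine ensures_bin ?_ (ensures_halt ?_)
  · rw [e10, e11]
    exact (hd n G).trans_le (Nat.pow_le_pow_right (by norm_num) (hle d (by omega)))
  · simp only [Store.setReg, Function.update_self, e10, e11]

/-! ### Integer-valued linear combinations of easy problems -/

theorem polyBounded_const (c : ℕ) : PolyBounded fun _ _ => c :=
  ⟨c, fun n _ => Nat.lt_two_pow_self.trans_le
    (Nat.pow_le_pow_right (by norm_num) (Nat.le_mul_of_pos_right _ (by omega)))⟩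

theorem PolyBounded.of_le {c c' : ∀ n : ℕ, SimpleGraph (Fin n) → ℕ} (h : PolyBounded c)
    (hle : ∀ n G, c' n G ≤ c n G) : PolyBounded c' := by
  obtain ⟨d, hd⟩ := h
  exact ⟨d, fun n G => (hle n G).trans_lt (hd n G)⟩

theorem PolyBounded.exists_mul {c c' : ∀ n : ℕ, SimpleGraph (Fin n) → ℕ} (h : PolyBounded c)
    (h' : PolyBounded c') :
    ∃ d, ∀ n G, (c n G + 1) * (c' n G + 1) ≤ 2 ^ (d * (Nat.log 2 n + 1)) := by
  obtain ⟨d, hd⟩ := h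
  obtain ⟨d', hd'⟩ := h'
  refine ⟨d + d', fun n G => ?_⟩
  rw [add_mul d, pow_add]
  exact Nat.mul_le_mul (hd n G) (hd' n G)

theorem PolyBounded.add {c c' : ∀ n : ℕ, SimpleGraph (Fin n) → ℕ} (h : PolyBounded c)
    (h' : PolyBounded c') : PolyBounded fun n G => c n G + c' n G := by
  obtain ⟨d, hd⟩ := h.exists_mul h'
  exact ⟨d, fun n G => lt_of_lt_of_le (by nlinarith) (hd n G)⟩

theorem PolyBounded.mul {c c' : ∀ n : ℕ, SimpleGraph (Fin n) → ℕ} (h : PolyBounded c)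
    (h' : PolyBounded c') : PolyBounded fun n G => c n G * c' n G := by
  obtain ⟨d, hd⟩ := h.exists_mul h'
  exact ⟨d, fun n G => lt_of_lt_of_le (by nlinarith) (hd n G)⟩

theorem PolyBounded.tensor {c : ∀ n : ℕ, SimpleGraph (Fin n) → ℕ} (h : PolyBounded c) {k : ℕ}
    (F : LoopGraph (Fin k)) :
    PolyBounded fun n G => c (n * k) (SubgraphCounting.tensor G F) := by
  obtain ⟨d, hd⟩ := h
  refine ⟨d * (k + 1), fun n G => (hd _ _).trans_le (Nat.pow_le_pow_right (by norm_num) ?_)⟩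
  rw [mul_assoc]
  refine Nat.mul_le_mul_left d ?_
  have hlog : Nat.log 2 (n * k) + 1 ≤ Nat.log 2 n + 1 + k := by
    rcases Nat.eq_zero_or_pos (n * k) with h0 | h0
    · rw [h0]
      simp
      omega
    · refine Nat.log_lt_of_lt_pow h0.ne' ?_
      rw [pow_add]
      exact Nat.mul_lt_mul'' (lt_two_pow_log_succ n) Nat.lt_two_pow_self
  nlinarith [Nat.zero_le (Nat.log 2 n * k)]

/-- Differences of polynomially bounded parameters that are easy to compute. -/
def EasyInt (f : ∀ n : ℕ, SimpleGraph (Fin n) → ℤ) : Prop :=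
  ∃ c c' : ∀ n : ℕ, SimpleGraph (Fin n) → ℕ, IsEasy c ∧ IsEasy c' ∧ PolyBounded c ∧
    PolyBounded c' ∧ ∀ n G, f n G = c n G - c' n G

theorem IsEasy.easyInt {c : ∀ n : ℕ, SimpleGraph (Fin n) → ℕ} (h : IsEasy c)
    (hb : PolyBounded c) : EasyInt fun n G => c n G :=
  ⟨c, fun _ _ => 0, h, isEasy_const 0, hb, polyBounded_const 0, by simp⟩

theorem easyInt_zero : EasyInt fun _ _ => 0 :=
  (isEasy_const 0).easyInt (polyBounded_const 0)

theorem EasyInt.neg {f : ∀ n : ℕ, SimpleGraph (Fin n) → ℤ} (h : EasyInt f) :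
    EasyInt fun n G => -f n G := by
  obtain ⟨c, c', hc, hc', hb, hb', hf⟩ := h
  exact ⟨c', c, hc', hc, hb', hb, fun n G => by simp only [hf, neg_sub]⟩

theorem EasyInt.add {f g : ∀ n : ℕ, SimpleGraph (Fin n) → ℤ} (hf : EasyInt f) (hg : EasyInt g) :
    EasyInt fun n G => f n G + g n G := by
  obtain ⟨c, c', hc, hc', hb, hb', hf⟩ := hf
  obtain ⟨e, e', he, he', hd, hd', hg⟩ := hg
  refine ⟨fun n G => c n G + e n G, fun n G => c' n G + e' n G, hc.bin he .add (hb.add hd),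
    hc'.bin he' .add (hb'.add hd'), hb.add hd, hb'.add hd', fun n G => ?_⟩
  simp only [hf, hg]
  push_cast
  ring

theorem EasyInt.natCast_mul {f : ∀ n : ℕ, SimpleGraph (Fin n) → ℤ} (hf : EasyInt f) (a : ℕ) :
    EasyInt fun n G => a * f n G := by
  obtain ⟨c, c', hc, hc', hb, hb', hf⟩ := hf
  have hm := (polyBounded_const a).mul hb
  have hm' := (polyBounded_const a).mul hb'
  refine ⟨fun n G => a * c n G, fun n G => a * c' n G, (isEasy_const a).bin hc .mul hm,
    (isEasy_const a).bin hc' .mul hm', hm, hm', fun n G => ?_⟩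
  simp only [hf]
  push_cast
  ring

theorem EasyInt.const_mul {f : ∀ n : ℕ, SimpleGraph (Fin n) → ℤ} (hf : EasyInt f) (z : ℤ) :
    EasyInt fun n G => z * f n G := by
  obtain ⟨a, rfl | rfl⟩ := z.eq_nat_or_neg
  · exact hf.natCast_mul a
  · simpa using (hf.natCast_mul a).neg

theorem easyInt_sum {ι : Type*} (s : Finset ι) {f : ι → ∀ n : ℕ, SimpleGraph (Fin n) → ℤ}
    (h : ∀ i ∈ s, EasyInt (f i)) : EasyInt fun n G => ∑ i ∈ s, f i n G := by
  classical
  induction s using Finset.induction_on with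
  | empty => simpa using easyInt_zero
  | insert i s hi ih =>
    simp only [Finset.sum_insert hi]
    exact (h i (by simp)).add (ih fun j hj => h j (by simp [hj]))

/-- Since `f` is a nonnegative multiple of `a`, truncated subtraction and integer division are exact
here. -/
theorem EasyInt.isEasy_of_natCast_mul {f : ∀ n : ℕ, SimpleGraph (Fin n) → ℤ} (hf : EasyInt f)
    {a : ℕ} (ha : a ≠ 0) {cnt : ∀ n : ℕ, SimpleGraph (Fin n) → ℕ}
    (h : ∀ n G, (a : ℤ) * cnt n G = f n G) : IsEasy cnt := by
  obtain ⟨c, c', hc, hc', hb, hb', hf⟩ := hf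
  have hsub : PolyBounded fun n G => c n G - c' n G := hb.of_le fun n G => Nat.sub_le _ _
  have hdiv : PolyBounded fun n G => (c n G - c' n G) / a :=
    hsub.of_le fun n G => Nat.div_le_self _ _
  have key : cnt = fun n G => (c n G - c' n G) / a := by
    funext n G
    have h1 := h n G
    rw [hf] at h1
    have h2 : a * cnt n G = c n G - c' n G := by
      have : (0 : ℤ) ≤ a * cnt n G := by positivity
      zify [show c' n G ≤ c n G by omega]
      exact h1
    rw [← h2, Nat.mul_div_cancel_left _ (Nat.pos_of_ne_zero ha)]
  rw [key]
  exact (hc.bin hc' .sub hsub).bin (isEasy_const a) .div hdiv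

theorem EasyInt.isEasy_of_mul {f : ∀ n : ℕ, SimpleGraph (Fin n) → ℤ} (hf : EasyInt f)
    {z : ℤ} (hz : z ≠ 0) {cnt : ∀ n : ℕ, SimpleGraph (Fin n) → ℕ}
    (h : ∀ n G, z * cnt n G = f n G) : IsEasy cnt := by
  obtain ⟨a, rfl | rfl⟩ := z.eq_nat_or_neg
  · exact hf.isEasy_of_natCast_mul (by simpa using hz) h
  · refine hf.neg.isEasy_of_natCast_mul (a := a) (by simpa using hz) fun n G => ?_
    rw [← h]
    ring

end SubgraphCounting

/-! ### Signed sums over permutations and the domination order -/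

namespace SubgraphCounting

open Equiv

/-! ### Homomorphisms that are constant on the orbits of a permutation -/

section Counting

variable {V : Type*} {X Y : Type*}

/-- The homomorphisms from `H` to `R` that are constant on the orbits of `σ`. -/
def fixHoms (H : SimpleGraph V) (σ : Perm V) (R : X → X → Prop) : Set (V → X) :=
  {φ | (∀ u v, H.Adj u v → R (φ u) (φ v)) ∧ ∀ v, φ (σ v) = φ v}

/-- The number of homomorphisms from `H` to `R` that are constant on the orbits of `σ`. -/
noncomputable def fixCount (H : SimpleGraph V) (σ : Perm V) (R : X → X → Prop) : ℕ :=
  (fixHoms H σ R).ncard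

theorem fixHoms_eq_of_sameCycle {H : SimpleGraph V} {σ : Perm V} {R : X → X → Prop}
    {φ : V → X} (hφ : φ ∈ fixHoms H σ R) {u v : V} (h : σ.SameCycle u v) : φ u = φ v := by
  obtain ⟨i, rfl⟩ := h
  induction i with
  | zero => simp
  | succ i ih =>
    rw [add_comm, zpow_add, Perm.mul_apply, zpow_one, hφ.2, ih]
  | pred i ih =>
    rw [sub_eq_neg_add, zpow_add, Perm.mul_apply, zpow_neg, zpow_one, ← hφ.2 (σ⁻¹ _), ih]
    simp

theorem fixCount_equiv (H : SimpleGraph V) (σ : Perm V) (e : X ≃ Y) (R : Y → Y → Prop) :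
    fixCount H σ (fun x x' => R (e x) (e x')) = fixCount H σ R := by
  rw [fixCount, fixCount, ← Set.ncard_image_of_injective _ e.injective.comp_left]
  congr 1
  ext φ
  constructor
  · rintro ⟨ψ, hψ, rfl⟩
    exact ⟨hψ.1, fun v => congrArg e (hψ.2 v)⟩
  · intro hφ
    refine ⟨e.symm ∘ φ, ⟨by simpa using hφ.1, fun v => congrArg e.symm (hφ.2 v)⟩, ?_⟩
    funext v
    simp

theorem fixCount_prod (H : SimpleGraph V) (σ : Perm V) (R : X → X → Prop) (S : Y → Y → Prop) :
    fixCount H σ (fun x x' : X × Y => R x.1 x'.1 ∧ S x.2 x'.2) =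
      fixCount H σ R * fixCount H σ S := by
  rw [fixCount, fixCount, fixCount, ← Set.ncard_prod,
    ← Set.ncard_image_of_injective _ (Equiv.arrowProdEquivProdArrow V (fun _ => X)
      (fun _ => Y)).injective]
  congr 1
  ext ⟨φ, ψ⟩
  constructor
  · rintro ⟨χ, hχ, heq⟩
    cases heq
    exact ⟨⟨fun u v h => (hχ.1 u v h).1, fun v => congrArg Prod.fst (hχ.2 v)⟩,
      ⟨fun u v h => (hχ.1 u v h).2, fun v => congrArg Prod.snd (hχ.2 v)⟩⟩
  · rintro ⟨hφ, hψ⟩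
    exact ⟨fun v => (φ v, ψ v), ⟨fun u v h => ⟨hφ.1 u v h, hψ.1 u v h⟩,
      fun v => Prod.ext (hφ.2 v) (hψ.2 v)⟩, rfl⟩

theorem ncard_eq_sum_ite {α : Type*} [Fintype α] (p : α → Prop) [DecidablePred p] :
    ({a | p a}.ncard : ℤ) = ∑ a, if p a then 1 else 0 := by
  rw [Finset.sum_boole, ← Set.ncard_coe_finset]
  simp

/-- For injective `φ` only the identity contributes. Otherwise `φ u = φ v` for some `u ≠ v`, and `σ
↦ σ * swap u v` is a sign-reversing involution preserving `φ ∘ σ = φ`. -/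
theorem sum_sign_of_comp_eq [Fintype V] [DecidableEq V] [DecidableEq X] (φ : V → X)
    [Decidable (Function.Injective φ)] :
    ∑ σ : Perm V, (if ∀ v, φ (σ v) = φ v then (Perm.sign σ : ℤ) else 0) =
      if Function.Injective φ then 1 else 0 := by
  split_ifs with hφ
  · rw [Finset.sum_eq_single 1]
    · simp
    · intro σ _ hσ
      rw [if_neg]
      exact fun h => hσ (Equiv.ext fun v => hφ (h v))
    · simp
  · obtain ⟨u, v, huv, hne⟩ : ∃ u v, φ u = φ v ∧ u ≠ v := by
      simpa [Function.Injective] using hφ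
    have hswap : ∀ x, φ (swap u v x) = φ x := fun x => by
      rw [swap_apply_def]
      split_ifs with h1 h2
      · rw [h1, huv]
      · rw [h2, huv]
      · rfl
    refine Finset.sum_involution (fun σ _ => σ * swap u v) ?_ ?_ (fun _ _ => Finset.mem_univ _) ?_
    · intro σ _
      have : (∀ x, φ ((σ * swap u v) x) = φ x) ↔ ∀ x, φ (σ x) = φ x := by
        constructor
        · intro h x
          have := h (swap u v x)
          rwa [Perm.mul_apply, swap_apply_self, hswap] at this
        · intro h x
          rw [Perm.mul_apply, h, hswap]
      simp only [this]
      split_ifs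
      · simp [Perm.sign_swap hne]
      · simp
    · intro σ _ _ h
      exact hne (by simpa using h)
    · intro σ _
      simp [mul_assoc]

theorem ncard_injective_eq_sum [Fintype V] [DecidableEq V] [Finite X] (H : SimpleGraph V)
    (R : X → X → Prop) :
    ({φ : V → X | (∀ u v, H.Adj u v → R (φ u) (φ v)) ∧ Function.Injective φ}.ncard : ℤ) =
      ∑ σ : Perm V, (Perm.sign σ : ℤ) * fixCount H σ R := by
  classical
  have := Fintype.ofFinite X
  simp only [fixCount, fixHoms, ncard_eq_sum_ite, Finset.mul_sum]
  rw [Finset.sum_comm]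
  refine Finset.sum_congr rfl fun φ _ => ?_
  by_cases h : ∀ u v, H.Adj u v → R (φ u) (φ v)
  · simp only [mul_ite, mul_one, mul_zero]
    rw [if_congr (and_iff_right h) rfl rfl, ← sum_sign_of_comp_eq φ]
    exact Finset.sum_congr rfl fun σ _ => (if_congr (and_iff_right h) rfl rfl).symm
  · simp [h]

theorem fixCount_subtype (H : SimpleGraph V) (σ : Perm V) (R : X → X → Prop) (p : X → Prop) :
    fixCount H σ (fun x x' : {x // p x} => R x x') =
      {φ | φ ∈ fixHoms H σ R ∧ ∀ v, p (φ v)}.ncard := by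
  rw [fixCount, ← Set.ncard_image_of_injective _ (Subtype.val_injective (p := p)).comp_left]
  congr 1
  ext φ
  constructor
  · rintro ⟨ψ, hψ, rfl⟩
    exact ⟨⟨hψ.1, fun v => congrArg Subtype.val (hψ.2 v)⟩, fun v => (ψ v).2⟩
  · rintro ⟨hφ, hp⟩
    exact ⟨fun v => ⟨φ v, hp v⟩, ⟨hφ.1, fun v => Subtype.ext (hφ.2 v)⟩, rfl⟩

/-- Inclusion-exclusion over the set of missed points. -/
theorem ncard_surjective_eq_sum [Fintype V] [Fintype X] [DecidableEq X] (H : SimpleGraph V)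
    (σ : Perm V) (R : X → X → Prop) :
    ({φ | φ ∈ fixHoms H σ R ∧ Function.Surjective φ}.ncard : ℤ) =
      ∑ T : Finset X, (-1) ^ T.card * (fixCount H σ fun x x' : {x // x ∉ T} => R x x' : ℤ) := by
  classical
  simp only [fixCount_subtype, ncard_eq_sum_ite, Finset.mul_sum]
  rw [Finset.sum_comm]
  refine Finset.sum_congr rfl fun φ _ => ?_
  by_cases h : φ ∈ fixHoms H σ R
  · simp only [h, true_and, mul_ite, mul_one, mul_zero]
    rw [← Finset.sum_filter]
    -- The contributing `T` are the subsets of the complement of the image; their alternating sum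
    -- vanishes unless that complement is empty.
    have h1 : ({T | ∀ v, φ v ∉ T} : Finset (Finset X)) =
        (Finset.univ \ Finset.univ.image φ).powerset := by
      ext T
      simp only [Finset.mem_filter, Finset.mem_univ, true_and, Finset.mem_powerset,
        Finset.subset_iff, Finset.mem_sdiff, Finset.mem_image, not_exists]
      exact ⟨fun h x hx v hv => h v (hv ▸ hx), fun h v hv => h hv v rfl⟩
    rw [h1, Finset.sum_powerset_neg_one_pow_card]
    refine if_congr ?_ rfl rfl
    rw [Finset.sdiff_eq_empty_iff_subset, Finset.univ_subset_iff, Finset.eq_univ_iff_forall]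
    simp [Function.Surjective]
  · simp [h]

end Counting

/-! ### The quotient by the orbits of a permutation -/

section Quotient

variable {V : Type*} {X : Type*}

/-- The orbits of `σ`. -/
abbrev Orbits (σ : Perm V) : Type _ := Quotient (Perm.SameCycle.setoid σ)

/-- Adjacency of orbits. -/
def orbitAdj (H : SimpleGraph V) (σ : Perm V) (a b : Orbits σ) : Prop :=
  ∃ u v, Quotient.mk _ u = a ∧ Quotient.mk _ v = b ∧ H.Adj u v

/-- There is a homomorphism from the quotient by `σ` to the quotient by `τ` that is surjective on
the vertices. -/
def Dominates (H : SimpleGraph V) (σ τ : Perm V) : Prop :=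
  ∃ ψ ∈ fixHoms H σ (orbitAdj H τ), Function.Surjective ψ

theorem dominates_refl (H : SimpleGraph V) (σ : Perm V) : Dominates H σ σ := by
  refine ⟨Quotient.mk _, ⟨fun u v h => ⟨u, v, rfl, rfl, h⟩, fun v => Quotient.sound ?_⟩,
    Quotient.mk_surjective⟩
  exact (Perm.sameCycle_apply_left).2 (Perm.SameCycle.refl σ v)

theorem fixHoms_out_eq {H : SimpleGraph V} {τ : Perm V} {R : X → X → Prop} {φ : V → X}
    (hφ : φ ∈ fixHoms H τ R) (v : V) :
    φ (Quotient.out (Quotient.mk (Perm.SameCycle.setoid τ) v)) = φ v :=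
  fixHoms_eq_of_sameCycle hφ (Quotient.mk_out (s := Perm.SameCycle.setoid τ) v)

/-- Here `φ` factors through the orbits of `τ`, so it can be composed with `ψ`; the chosen
representatives do not matter. -/
theorem comp_out_mem_fixHoms {H : SimpleGraph V} {σ τ : Perm V} {R : X → X → Prop} {φ : V → X}
    (hφ : φ ∈ fixHoms H τ R) {ψ : V → Orbits τ} (hψ : ψ ∈ fixHoms H σ (orbitAdj H τ)) :
    (fun v => φ (ψ v).out) ∈ fixHoms H σ R := by
  refine ⟨fun u v h => ?_, fun v => by simp only [hψ.2]⟩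
  obtain ⟨x, y, hx, hy, hxy⟩ := hψ.1 u v h
  have := hφ.1 x y hxy
  rwa [← fixHoms_out_eq hφ x, ← fixHoms_out_eq hφ y, hx, hy] at this

theorem Dominates.trans {H : SimpleGraph V} {σ τ υ : Perm V} (h : Dominates H σ τ)
    (h' : Dominates H τ υ) : Dominates H σ υ := by
  obtain ⟨ψ, hψ, hs⟩ := h
  obtain ⟨φ, hφ, hs'⟩ := h'
  refine ⟨_, comp_out_mem_fixHoms hφ hψ, fun z => ?_⟩
  obtain ⟨y, rfl⟩ := hs' z
  obtain ⟨x, hx⟩ := hs (Quotient.mk _ y)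
  exact ⟨x, by simp only [hx]; exact fixHoms_out_eq hφ y⟩

/-- Precomposition with a surjection is injective. -/
theorem Dominates.fixCount_le [Finite V] [Finite X] {H : SimpleGraph V} {σ τ : Perm V}
    (h : Dominates H σ τ) (R : X → X → Prop) : fixCount H τ R ≤ fixCount H σ R := by
  obtain ⟨ψ, hψ, hs⟩ := h
  refine Set.ncard_le_ncard_of_injOn (fun φ v => φ (ψ v).out)
    (fun φ hφ => comp_out_mem_fixHoms hφ hψ) ?_ (Set.toFinite _)
  intro φ hφ φ' hφ' heq
  funext y
  obtain ⟨x, hx⟩ := hs (Quotient.mk _ y)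
  have := congrFun heq x
  simp only [hx] at this
  rwa [fixHoms_out_eq hφ, fixHoms_out_eq hφ'] at this

theorem Dominates.card_le [Finite V] {H : SimpleGraph V} {σ τ : Perm V} (h : Dominates H σ τ) :
    Nat.card (Orbits τ) ≤ Nat.card (Orbits σ) := by
  obtain ⟨ψ, hψ, hs⟩ := h
  refine Nat.card_le_card_of_surjective
    (Quotient.lift ψ fun u v h => fixHoms_eq_of_sameCycle hψ h) fun z => ?_
  obtain ⟨x, rfl⟩ := hs z
  exact ⟨Quotient.mk _ x, rfl⟩

/-- Orbits are fixed points or nontrivial cycles; `f` sends a vertex to whichever represents its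
orbit. -/
theorem card_orbits [Fintype V] [DecidableEq V] (σ : Perm V) :
    Nat.card (Orbits σ) + σ.support.card = Fintype.card V + σ.cycleType.card := by
  let f : V → Perm V ⊕ V := fun v => if σ v = v then .inr v else .inl (σ.cycleOf v)
  have hf : ∀ u v, f u = f v ↔ σ.SameCycle u v := by
    intro u v
    by_cases hu : σ u = u <;> by_cases hv : σ v = v
    · simp only [f, hu, hv, if_true, Sum.inr.injEq]
      exact ⟨fun h => h ▸ Perm.SameCycle.refl _ _, fun h => h.eq_of_left hu⟩
    · simp only [f, hu, hv, if_true, if_false, reduceCtorEq, false_iff]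
      exact fun h => hv (h.apply_eq_self_iff.1 hu)
    · simp only [f, hu, hv, if_true, if_false, reduceCtorEq, false_iff]
      exact fun h => hu (h.apply_eq_self_iff.2 hv)
    · simp only [f, hu, hv, if_false, Sum.inl.injEq]
      refine ⟨fun h => ?_, fun h => h.cycleOf_eq⟩
      by_contra hcon
      have h1 : σ.cycleOf u v = v := Perm.cycleOf_apply_of_not_sameCycle hcon
      rw [h, Perm.cycleOf_apply_self] at h1
      exact hv h1
  have h1 : Nat.card (Orbits σ) = (Finset.univ.image f).card := by
    rw [← Set.ncard_coe_finset, Finset.coe_image, Finset.coe_univ, Set.image_univ]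
    refine Nat.card_congr ((Quotient.congr (Equiv.refl V)
      fun u v => (hf u v).symm).trans
      (Setoid.quotientKerEquivRange f))
  have h2 : Finset.univ.image f =
      σ.cycleFactorsFinset.disjSum ({v | σ v = v} : Finset V) := by
    ext x
    rcases x with c | v
    · simp only [Finset.mem_image, Finset.mem_univ, true_and, Finset.inl_mem_disjSum]
      constructor
      · rintro ⟨v, hv⟩
        by_cases h : σ v = v
        · simp [f, h] at hv
        · simp only [f, h, if_false, Sum.inl.injEq] at hv
          rw [← hv, Perm.cycleOf_mem_cycleFactorsFinset_iff, Perm.mem_support]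
          exact h
      · intro hc
        obtain ⟨v, hv⟩ := (Perm.mem_cycleFactorsFinset_iff.1 hc).1.nonempty_support
        have hv' : σ v ≠ v := by
          rw [← (Perm.mem_cycleFactorsFinset_iff.1 hc).2 v hv]
          exact Perm.mem_support.1 hv
        exact ⟨v, by simp only [f, hv', if_false, Perm.cycle_is_cycleOf hv hc]⟩
    · simp only [Finset.mem_image, Finset.mem_univ, true_and, Finset.inr_mem_disjSum,
        Finset.mem_filter]
      constructor
      · rintro ⟨u, hu⟩
        by_cases h : σ u = u
        · simp only [f, h, if_true, Sum.inr.injEq] at hu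
          exact hu ▸ h
        · simp [f, h] at hu
      · exact fun h => ⟨v, by simp [f, h]⟩
  have h3 : ({v | σ v = v} : Finset V).card + σ.support.card = Fintype.card V := by
    have := Finset.card_filter_add_card_filter_not (s := Finset.univ) (fun v => σ v = v)
    rwa [Finset.card_univ] at this
  have h4 : σ.cycleType.card = σ.cycleFactorsFinset.card := by simp [Perm.cycleType_def]
  rw [h1, h2, Finset.card_disjSum, h4]
  omega

/-- The sign is the parity of `|V|` minus the number of orbits. -/
theorem sign_eq_of_card_orbits_eq [Fintype V] [DecidableEq V] {σ τ : Perm V}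
    (h : Nat.card (Orbits σ) = Nat.card (Orbits τ)) : Perm.sign σ = Perm.sign τ := by
  have hσ := card_orbits σ
  have hτ := card_orbits τ
  rw [Perm.sign_of_cycleType, Perm.sign_of_cycleType, Perm.sum_cycleType, Perm.sum_cycleType,
    Int.units_pow_eq_pow_mod_two, Int.units_pow_eq_pow_mod_two _ (τ.support.card + _)]
  congr 1
  omega

end Quotient

end SubgraphCounting

/-! ### The two reductions between injective and quotient counts -/

namespace SubgraphCounting

open Equiv

/-! ### Counting problems in terms of permutations -/

theorem injCount_eq_ncard {V W : Type*} (H : SimpleGraph V) (G : SimpleGraph W) :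
    injCount H G =
      {φ : V → W | (∀ u v, H.Adj u v → G.Adj (φ u) (φ v)) ∧ Function.Injective φ}.ncard := by
  refine Nat.card_eq_of_bijective (fun φ : {φ : H →g G // Function.Injective φ} =>
    (⟨φ.1, fun u v h => φ.1.map_rel h, φ.2⟩ :
      {φ : V → W | (∀ u v, H.Adj u v → G.Adj (φ u) (φ v)) ∧ Function.Injective φ})) ⟨?_, ?_⟩
  · intro φ φ' h
    exact Subtype.ext (DFunLike.coe_injective (congrArg Subtype.val h))
  · rintro ⟨φ, h, hi⟩
    exact ⟨⟨⟨φ, fun {a b} hab => h a b hab⟩, hi⟩, rfl⟩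

section Partition

variable {V : Type*} [Fintype V] [DecidableEq V]

/-- The parts of `P` are the orbits of `σ`. -/
def IsOrbitPartition (σ : Perm V) (P : Finpartition (Finset.univ : Finset V)) : Prop :=
  ∀ u v, σ.SameCycle u v ↔ v ∈ P.part u

theorem exists_isOrbitPartition_of_perm (σ : Perm V) :
    ∃ P : Finpartition (Finset.univ : Finset V), IsOrbitPartition σ P := by
  classical
  exact ⟨Finpartition.ofSetoid (Perm.SameCycle.setoid σ), fun u v =>
    (Finpartition.mem_part_ofSetoid_iff_rel (s := Perm.SameCycle.setoid σ)).symm⟩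

/-- Glue together permutations that act as one cycle on each part. -/
theorem exists_perm_isOrbitPartition (P : Finpartition (Finset.univ : Finset V)) :
    ∃ σ : Perm V, IsOrbitPartition σ P := by
  choose f hf _ using fun A : Finset V => A.exists_cycleOn
  have hself : ∀ v, v ∈ P.part v := fun v => P.mem_part (Finset.mem_univ v)
  have hpart : ∀ {u v}, v ∈ P.part u → P.part v = P.part u := fun {u v} h =>
    P.part_eq_of_mem (P.part_mem.2 (Finset.mem_univ u)) h
  have hmem : ∀ v, f (P.part v) v ∈ P.part v := fun v => (hf (P.part v)).1.mapsTo (hself v)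
  have hinj : Function.Injective fun v => f (P.part v) v := by
    intro u v h
    have h1 := hpart (hmem u)
    have h2 := hpart (hmem v)
    simp only at h
    rw [h, h2] at h1
    rw [h1] at h
    exact (f (P.part u)).injective h
  refine ⟨Equiv.ofBijective _ (Finite.injective_iff_bijective.1 hinj), fun u v => ?_⟩
  set σ : Perm V := Equiv.ofBijective _ (Finite.injective_iff_bijective.1 hinj) with hσ
  have hσ_apply : ∀ x, σ x = f (P.part x) x := fun x => rfl
  have hpow : ∀ i : ℕ, (σ ^ i) u ∈ P.part u ∧ (σ ^ i) u = (f (P.part u) ^ i) u := by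
    intro i
    induction i with
    | zero => exact ⟨hself u, rfl⟩
    | succ i ih =>
      rw [pow_succ', pow_succ', Perm.mul_apply, Perm.mul_apply, hσ_apply, ← ih.2, hpart ih.1]
      exact ⟨(hf (P.part u)).1.mapsTo ih.1, rfl⟩
  constructor
  · intro h
    obtain ⟨i, -, rfl⟩ := h.exists_pow_eq'
    exact (hpow i).1
  · intro h
    obtain ⟨i, -, hi⟩ := ((hf (P.part u)).2 (hself u) h).exists_pow_eq'
    exact ⟨i, by rw [zpow_natCast, (hpow i).2, hi]⟩

theorem homCount_quotientGraph {W : Type*} (H : SimpleGraph V) {σ : Perm V}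
    {P : Finpartition (Finset.univ : Finset V)} (h : IsOrbitPartition σ P) (G : SimpleGraph W) :
    homCount (quotientGraph H P) G = fixCount H σ G.Adj := by
  have hself : ∀ v, v ∈ P.part v := fun v => P.mem_part (Finset.mem_univ v)
  let π : V → {U : Finset V // U ∈ P.parts} := fun v =>
    ⟨P.part v, P.part_mem.2 (Finset.mem_univ v)⟩
  have hπ : ∀ (U : {U : Finset V // U ∈ P.parts}) v, v ∈ U.1 → π v = U := fun U v hv =>
    Subtype.ext (P.part_eq_of_mem U.2 hv)
  have hπs : ∀ u v, π u = π v ↔ σ.SameCycle u v := by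
    intro u v
    rw [h u v]
    constructor
    · intro huv
      have : P.part u = P.part v := congrArg Subtype.val huv
      rw [this]
      exact hself v
    · exact fun huv => (hπ (π u) v huv).symm
  refine Nat.card_eq_of_bijective (fun ψ : (quotientGraph H P).Adj →r G.Adj =>
    (⟨fun v => ψ (π v), ⟨fun u v huv => ψ.map_rel ⟨u, hself u, v, hself v, huv⟩, fun v => ?_⟩⟩ :
      fixHoms H σ G.Adj)) ⟨?_, ?_⟩
  · exact congrArg ψ ((hπs _ _).2 (Perm.sameCycle_apply_left.2 (Perm.SameCycle.refl σ v)))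
  · intro ψ ψ' heq
    ext U
    obtain ⟨v, hv⟩ := P.nonempty_of_mem_parts U.2
    have := congrFun (congrArg Subtype.val heq) v
    simpa only [hπ U v hv] using this
  · rintro ⟨φ, hφ⟩
    choose r hr using fun U : {U : Finset V // U ∈ P.parts} => P.nonempty_of_mem_parts U.2
    have hφr : ∀ (U : {U : Finset V // U ∈ P.parts}) v, v ∈ U.1 → φ (r U) = φ v :=
      fun U v hv => fixHoms_eq_of_sameCycle hφ
        ((hπs _ _).1 ((hπ U _ (hr U)).trans (hπ U v hv).symm))
    refine ⟨⟨fun U => φ (r U), ?_⟩, Subtype.ext (funext fun v => hφr (π v) v (hself v))⟩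
    rintro U U' ⟨u, hu, u', hu', hadj⟩
    rw [hφr U u hu, hφr U' u' hu']
    exact hφ.1 u u' hadj

theorem injCount_eq_sum {W : Type*} [Finite W] (H : SimpleGraph V) (G : SimpleGraph W) :
    (injCount H G : ℤ) = ∑ σ : Perm V, (Perm.sign σ : ℤ) * fixCount H σ G.Adj := by
  rw [injCount_eq_ncard, ncard_injective_eq_sum]

theorem polyBounded_ncard (s : ∀ n : ℕ, SimpleGraph (Fin n) → Set (V → Fin n)) :
    PolyBounded fun n G => (s n G).ncard := by
  refine ⟨Fintype.card V + 1, fun n G => ?_⟩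
  calc (s n G).ncard ≤ Nat.card (V → Fin n) := Set.ncard_le_card _
    _ = n ^ Fintype.card V := by simp
    _ ≤ (2 ^ (Nat.log 2 n + 1)) ^ Fintype.card V :=
        Nat.pow_le_pow_left (lt_two_pow_log_succ n).le _
    _ < 2 ^ ((Fintype.card V + 1) * (Nat.log 2 n + 1)) := by
        rw [← pow_mul]
        refine Nat.pow_lt_pow_right (by norm_num) ?_
        rw [mul_comm]
        exact Nat.mul_lt_mul_of_pos_right (Nat.lt_succ_self _) (Nat.succ_pos _)

theorem polyBounded_fixCount (H : SimpleGraph V) (σ : Perm V) :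
    PolyBounded fun _ G => fixCount H σ G.Adj :=
  polyBounded_ncard fun _ G => fixHoms H σ G.Adj

theorem polyBounded_injCount (H : SimpleGraph V) : PolyBounded fun _ G => injCount H G := by
  simp only [injCount_eq_ncard]
  exact polyBounded_ncard fun _ _ => _

theorem injCount_tensor (H : SimpleGraph V) {n k : ℕ} (G : SimpleGraph (Fin n))
    (F : LoopGraph (Fin k)) :
    (injCount H (tensor G F) : ℤ) =
      ∑ σ : Perm V, (Perm.sign σ : ℤ) * fixCount H σ F.Adj * fixCount H σ G.Adj := by
  rw [injCount_eq_sum]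
  refine Finset.sum_congr rfl fun σ _ => ?_
  have h1 : fixCount H σ (tensor G F).Adj = fixCount H σ G.Adj * fixCount H σ F.Adj :=
    (fixCount_equiv H σ finProdFinEquiv.symm fun x y : Fin n × Fin k =>
      G.Adj x.1 y.1 ∧ F.Adj x.2 y.2).trans (fixCount_prod H σ G.Adj F.Adj)
  rw [h1]
  push_cast
  ring

/-- Counting injective homomorphisms to the tensor product with `F` is easy. -/
theorem easyInt_sum_fixCount {X : Type*} [Fintype X] {H : SimpleGraph V} (h : InjCntEasy H)
    {R : X → X → Prop} (hR : ∀ x y, R x y → R y x) :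
    EasyInt fun _ G =>
      ∑ σ : Perm V, (Perm.sign σ : ℤ) * fixCount H σ R * fixCount H σ G.Adj := by
  let e := (Fintype.equivFin X).symm
  let F : LoopGraph (Fin (Fintype.card X)) := ⟨fun x y => R (e x) (e y), fun x y => hR _ _⟩
  have key := (IsEasy.tensor h F).easyInt ((polyBounded_injCount H).tensor F)
  simp only [injCount_tensor] at key
  have hF : ∀ σ : Perm V, fixCount H σ F.Adj = fixCount H σ R := fun σ => fixCount_equiv H σ e R
  simpa only [hF] using key

/-- The number of injective homomorphisms to the tensor product with `R` whose projection to the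
second factor is surjective is easy. -/
theorem easyInt_sum_surjective {X : Type*} [Fintype X] {H : SimpleGraph V} (h : InjCntEasy H)
    {R : X → X → Prop} (hR : ∀ x y, R x y → R y x) :
    EasyInt fun _ G => ∑ σ : Perm V, (Perm.sign σ : ℤ) *
      {φ | φ ∈ fixHoms H σ R ∧ Function.Surjective φ}.ncard * fixCount H σ G.Adj := by
  classical
  have key := easyInt_sum (Finset.univ : Finset (Finset X)) fun T _ =>
    (easyInt_sum_fixCount h (R := fun x y : {x // x ∉ T} => R x y) fun x y => hR x y).const_mul
      ((-1) ^ T.card)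
  convert key using 3 with n G
  simp only [ncard_surjective_eq_sum, Finset.mul_sum, Finset.sum_mul]
  rw [Finset.sum_comm]
  refine Finset.sum_congr rfl fun T _ => Finset.sum_congr rfl fun σ _ => ?_
  ring

/-- Induction along strict domination, starting from the quotients that nothing strictly dominates.
It isolates the mutual domination class of `τ` in the surjective sum for the quotient by `τ`. -/
theorem isEasy_fixCount {H : SimpleGraph V} (h : InjCntEasy H) (τ : Perm V) :
    IsEasy fun _ G => fixCount H τ G.Adj := by
  classical
  let r : Perm V → Perm V → Prop := fun σ τ => Dominates H σ τ ∧ ¬ Dominates H τ σ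
  have htrans : IsTrans (Perm V) r :=
    ⟨fun a b c h₁ h₂ => ⟨h₁.1.trans h₂.1, fun h₃ => h₁.2 (h₂.1.trans h₃)⟩⟩
  have hirrefl : Std.Irrefl r := ⟨fun a h => h.2 h.1⟩
  have hwf : WellFounded r := Finite.wellFounded_of_trans_of_irrefl r
  induction τ using hwf.induction with
  | _ τ ih =>
  have : Fintype (Orbits τ) := Fintype.ofFinite _
  set N : Perm V → ℕ := fun σ =>
    {φ | φ ∈ fixHoms H σ (orbitAdj H τ) ∧ Function.Surjective φ}.ncard with hN
  have hN0 : ∀ σ, N σ ≠ 0 ↔ Dominates H σ τ := fun σ =>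
    Nat.pos_iff_ne_zero.symm.trans (Set.ncard_pos (Set.toFinite _))
  have hsum := easyInt_sum_surjective h (R := orbitAdj H τ)
    fun x y ⟨u, v, hu, hv, huv⟩ => ⟨v, u, hv, hu, huv.symm⟩
  have hstrict : EasyInt fun _ G => ∑ σ ∈ ({σ | r σ τ} : Finset (Perm V)),
      ((Perm.sign σ : ℤ) * N σ) * fixCount H σ G.Adj :=
    easyInt_sum _ fun σ hσ => ((ih σ (by simpa using hσ)).easyInt
      (polyBounded_fixCount H σ)).const_mul _
  have hpos : 0 < ∑ σ ∈ ({σ | Dominates H σ τ ∧ Dominates H τ σ} : Finset (Perm V)), N σ :=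
    Finset.sum_pos' (fun _ _ => Nat.zero_le _) ⟨τ, by simp [dominates_refl],
      Nat.pos_of_ne_zero ((hN0 τ).2 (dominates_refl H τ))⟩
  refine (hsum.add hstrict.neg).isEasy_of_mul (z := (Perm.sign τ : ℤ) *
    ∑ σ ∈ ({σ | Dominates H σ τ ∧ Dominates H τ σ} : Finset (Perm V)), (N σ : ℤ)) ?_ fun n G => ?_
  · refine mul_ne_zero (Units.ne_zero _) ?_
    exact_mod_cast hpos.ne'
  -- Permutations that do not dominate `τ` have `N σ = 0` and drop out.
  · have hsplit : ∑ σ : Perm V, ((Perm.sign σ : ℤ) * N σ) * fixCount H σ G.Adj =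
        ∑ σ ∈ ({σ | Dominates H σ τ ∧ Dominates H τ σ} : Finset (Perm V)),
          ((Perm.sign σ : ℤ) * N σ) * fixCount H σ G.Adj +
        ∑ σ ∈ ({σ | r σ τ} : Finset (Perm V)), ((Perm.sign σ : ℤ) * N σ) * fixCount H σ G.Adj := by
      rw [← Finset.sum_filter_add_sum_filter_not _ (fun σ => Dominates H τ σ)]
      congr 1
      · refine (Finset.sum_subset (fun σ hσ => ?_) fun σ hσ hσ' => ?_).symm
        · simp_all
        · have : N σ = 0 := by
            by_contra hcon
            exact hσ' (by simpa using ⟨(hN0 σ).1 hcon, by simpa using hσ⟩)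
          simp [this]
      · refine (Finset.sum_subset (fun σ hσ => ?_) fun σ hσ hσ' => ?_).symm
        · simp_all [r]
        · have : N σ = 0 := by
            by_contra hcon
            exact hσ' (by simpa [r] using ⟨(hN0 σ).1 hcon, by simpa using hσ⟩)
          simp [this]
    rw [hsplit, add_neg_cancel_right, Finset.mul_sum, Finset.sum_mul]
    refine Finset.sum_congr rfl fun σ hσ => ?_
    obtain ⟨h₁, h₂⟩ : Dominates H σ τ ∧ Dominates H τ σ := by simpa using hσ
    -- Mutual domination gives inequalities both ways, hence equal orbit numbers, signs and counts.
    rw [sign_eq_of_card_orbits_eq (h₁.card_le.antisymm h₂.card_le),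
      (h₁.fixCount_le G.Adj).antisymm (h₂.fixCount_le G.Adj)]

end Partition

end SubgraphCounting

theorem lemma1p10 {V : Type*} [Fintype V] [DecidableEq V] (H : SimpleGraph V) :
    SubgraphCounting.InjCntEasy H ↔
      ∀ P : Finpartition (Finset.univ : Finset V),
        SubgraphCounting.HomCntEasy (SubgraphCounting.quotientGraph H P) := by
  constructor
  · intro h P
    obtain ⟨σ, hσ⟩ := SubgraphCounting.exists_perm_isOrbitPartition P
    have := SubgraphCounting.isEasy_fixCount h σ
    simpa only [SubgraphCounting.HomCntEasy, SubgraphCounting.homCount_quotientGraph H hσ]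
      using this
  · intro h
    have key := SubgraphCounting.easyInt_sum (Finset.univ : Finset (Equiv.Perm V)) fun σ _ => by
      obtain ⟨P, hP⟩ := SubgraphCounting.exists_isOrbitPartition_of_perm σ
      have hσ := h P
      simp only [SubgraphCounting.HomCntEasy, SubgraphCounting.homCount_quotientGraph H hP] at hσ
      exact (hσ.easyInt (SubgraphCounting.polyBounded_fixCount H σ)).const_mul
        (Equiv.Perm.sign σ : ℤ)
    refine key.isEasy_of_mul one_ne_zero fun n G => ?_
    rw [one_mul, SubgraphCounting.injCount_eq_sum]
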